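/- Let $S$ be a Polish space with Borel $\sigma$-field $\mathcal B$, let $\lambda$ be a $\sigma$-finite measure on $\mathcal B$, and let $X=(X_1,X_2,\ldots)$ be a sequence of $S$-valued random variables on a probability space $(\Omega,\mathcal A,P)$. For $n\ge 0$ let $\alpha_n$ be the $n$-th predictive measure, that is, a random probability measure on $S$ such that, for each $B\in\mathcal B$, $\alpha_n(\cdot)(B)$ is a version of $P(X_{n+1}\in B\mid X_1,\ldots,X_n)$ (for $n=0$, of $P(X_1\in B)$), and let $\alpha$ be a random probability measure on $S$ such that $\alpha_n\to\alpha$ weakly, almost surely. The sequence $X$ is called conditionally identically distributed (c.i.d.) if $(X_1,\ldots,X_n,X_{n+2})$ and $(X_1,\ldots,X_n,X_{n+1})$ have the same law for every $n\ge 0$, and exchangeable if, for every $n$, the law of $(X_1,\ldots,X_n)$ is invariant under all permutations of the coordinates; exchangeable sequences are c.i.d. For a probability measure $\nu$ on $\mathcal B$ let $\nu_d(B)=\sum_{x\in B}\nu\{x\}$ be its discrete part and $\nu_c=\nu-\nu_d$ its continuous part, and let $\Vert\cdot\Vert$ be the total variation norm. Theorem 2. Suppose $X$ is c.i.d. and $\alpha_c(\omega)\ll\lambda$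 for almost every $\omega$. Then $\Vert\alpha_n-\alpha\Vert\to 0$ almost surely if and only if $(*)$ there is a set $A_0\in\mathcal A$ such that $P(A_0)=1$ and $\alpha_n(\omega)\{x\}\to\alpha(\omega)\{x\}$ for all $x\in S$ and all $\omega\in A_0$. Moreover, condition $(*)$ is automatically true if $X$ is exchangeable; hence $\Vert\alpha_n-\alpha\Vert\to 0$ almost surely whenever $X$ is exchangeable and $\alpha_c\ll\lambda$ almost surely. -/

import Mathlib

open MeasureTheory ProbabilityTheory Filter Topology

noncomputable section

namespace PredictiveMeasure

variable {Ω S : Type*} [MeasurableSpace Ω] [MeasurableSpace S]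

/-- The vector of the first `n` observations. The sequence is indexed from `0`, so that `X i`
is the observation usually written `X_{i+1}`. -/
def firstObs (X : ℕ → Ω → S) (n : ℕ) (ω : Ω) : Fin n → S := fun i => X i ω

/-- The sigma-field generated by the first `n` observations (trivial for `n = 0`). -/
abbrev obsSigma (X : ℕ → Ω → S) (n : ℕ) : MeasurableSpace Ω :=
  MeasurableSpace.comap (firstObs X n) inferInstance

/-- `X` is conditionally identically distributed: for every `n ≥ 0`, the first `n` observations
together with the `(n+2)`-nd one have the same joint law as the first `n + 1` observations. -/
def IsCID (X : ℕ → Ω → S) (P : Measure Ω) : Prop :=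
  ∀ n : ℕ, IdentDistrib (fun ω => (firstObs X n ω, X (n + 1) ω))
    (fun ω => (firstObs X n ω, X n ω)) P P

/-- `X` is exchangeable: for every `n`, the joint law of the first `n` observations is invariant
under all permutations of the coordinates. -/
def IsExchangeable (X : ℕ → Ω → S) (P : Measure Ω) : Prop :=
  ∀ (n : ℕ) (σ : Equiv.Perm (Fin n)),
    IdentDistrib (fun ω (i : Fin n) => X (σ i) ω) (firstObs X n) P P

/-- A random probability measure on `S`: a map into the probability measures such that all
evaluations on measurable sets are measurable. -/
def IsRandomProbabilityMeasure (α : Ω → ProbabilityMeasure S) : Prop :=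
  ∀ B : Set S, MeasurableSet B → Measurable fun ω => (α ω : Measure S) B

/-- `αₙ` is a sequence of predictive measures of `X`: every `αₙ n` is a random probability
measure and, for each measurable `B`, `αₙ n (B)` is almost surely the conditional probability,
given the first `n` observations, that the next observation lies in `B`. -/
def IsPredictiveSequence (αₙ : ℕ → Ω → ProbabilityMeasure S) (X : ℕ → Ω → S)
    (P : Measure Ω) : Prop :=
  ∀ n : ℕ, IsRandomProbabilityMeasure (αₙ n) ∧
    ∀ B : Set S, MeasurableSet B →
      (fun ω => (αₙ n ω : Measure S).real B) =ᵐ[P] P⟦X n ⁻¹' B | obsSigma X n⟧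

/-- The discrete part of a measure: `B ↦ ∑_{x ∈ B} ν {x}`. -/
def discretePart (ν : Measure S) : Measure S :=
  Measure.sum fun x : S => ν {x} • Measure.dirac x

/-- The continuous part of a measure. -/
def continuousPart (ν : Measure S) : Measure S := ν - discretePart ν

/-- The total variation norm of the difference of two probability measures. -/
def tvNorm (μ ν : ProbabilityMeasure S) : ℝ :=
  ((μ : Measure S).toSignedMeasure - (ν : Measure S).toSignedMeasure).totalVariation.real Set.univ

/-- Outside a null event, the masses of all points converge simultaneously. -/
def AtomsConverge (αₙ : ℕ → Ω → ProbabilityMeasure S) (α : Ω → ProbabilityMeasure S)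
    (P : Measure Ω) : Prop :=
  ∃ A₀ : Set Ω, MeasurableSet A₀ ∧ P A₀ = 1 ∧
    ∀ x : S, ∀ ω ∈ A₀, Tendsto (fun n => (αₙ n ω : Measure S).real {x}) atTop
      (𝓝 ((α ω : Measure S).real {x}))

end PredictiveMeasure

end

open scoped ENNReal NNReal

namespace PredictiveMeasure

/-! For probability measures, total variation is twice the largest excess of `α` over `αₙ`, so
one-sided control suffices. Off the countable set of its atoms, `α` has a density `f` with respect
to a finite measure `ρ` equivalent to `lam`. With `gₙ` the density of the absolutely continuous part
of `αₙ`, only `(f - gₙ)⁺` and `(α{x} - αₙ{x})⁺` have to vanish, by dominated convergence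
(`tendsto_tvNorm_of_density_of_atoms`).

The c.i.d. property makes `αₙ` the conditional expectation of `α` given the first `n` observations.
On `Ω × S` with `P ⊗ ρ`, let `𝒢ₙ` be generated by these observations and the `S`-coordinate. Then
`E[f | 𝒢ₙ] ≤ gₙ`, while `E[f | 𝒢ₙ] → f` by Lévy's upward theorem, so `(f - gₙ)⁺ → 0`
(`IsCID.tendsto_rnDeriv_tsub`).

Under exchangeability almost surely every atom of `α` is an observed value: the next two
observations tie at a new point with probability at most `1/(n+1)`
(`IsExchangeable.measure_new_pair_le`), and they behave like two independent draws from `α`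
(`IsExchangeable.lintegral_prod_apply_eq`). At observed values the masses converge by a martingale
argument; at points of `α`-mass zero weak convergence is enough. -/

theorem kernel_ae_eq_of_forall_ae_eq_apply {Ω S : Type*} [MeasurableSpace Ω] [MeasurableSpace S]
    [MeasurableSpace.CountablyGenerated S] {P : Measure Ω} [IsFiniteMeasure P]
    {κ η : Kernel Ω S} [IsFiniteKernel κ] [IsFiniteKernel η]
    (h : ∀ B, MeasurableSet B → ∀ᵐ ω ∂P, κ ω B = η ω B) : κ =ᵐ[P] η := by
  -- Countable generation is what turns a null set for each `B` into a single null set: both kernels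
  -- give the same joint law with `P`, as rectangles show.
  refine Kernel.ae_eq_of_compProd_eq (Measure.ext_prod fun {s t} hs ht => ?_)
  rw [Measure.compProd_apply_prod hs ht, Measure.compProd_apply_prod hs ht]
  exact lintegral_congr_ae (ae_restrict_of_ae (h t ht))

/-! ### Total variation between probability measures. -/

section TotalVariation

variable {S : Type*} [MeasurableSpace S]

/-- `I` is the negative set of a Hahn decomposition of `μ - ν`. Equal total masses make the positive
and negative parts equally large, whence the factor 2. -/
theorem exists_tvNorm_eq (μ ν : ProbabilityMeasure S) :
    ∃ I : Set S, MeasurableSet I ∧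
      tvNorm μ ν = 2 * ((ν : Measure S).real I - (μ : Measure S).real I) ∧
      (∀ B, MeasurableSet B →
        |(μ : Measure S).real B - (ν : Measure S).real B| ≤ tvNorm μ ν) := by
  set s := (μ : Measure S).toSignedMeasure - (ν : Measure S).toSignedMeasure with hs
  have happ : ∀ B, MeasurableSet B → s B = (μ : Measure S).real B - (ν : Measure S).real B := by
    intro B hB
    rw [hs, Measure.toSignedMeasure_sub_apply hB]
  obtain ⟨i, hi, h1, h2, h3, h4⟩ := s.toJordanDecomposition_spec
  have htv : tvNorm μ ν = s i - s iᶜ := by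
    unfold tvNorm
    rw [← hs, SignedMeasure.totalVariation, measureReal_add_apply, h3, h4,
      SignedMeasure.toMeasureOfZeroLE_real_apply _ h1 hi MeasurableSet.univ,
      SignedMeasure.toMeasureOfLEZero_real_apply _ h2 hi.compl MeasurableSet.univ]
    simp [sub_eq_add_neg]
  have hc : s i + s iᶜ = 0 := by
    rw [happ i hi, happ _ hi.compl, probReal_compl_eq_one_sub hi, probReal_compl_eq_one_sub hi]
    ring
  refine ⟨iᶜ, hi.compl, ?_, fun B hB => ?_⟩
  · rw [htv]; linarith [happ _ hi.compl]
  · rw [← happ B hB, htv]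
    have e1 : s B = s (i ∩ B) + s (iᶜ ∩ B) := by
      rw [← VectorMeasure.of_union _ (hi.inter hB) (hi.compl.inter hB), Set.inter_comm i,
        Set.inter_comm iᶜ, Set.inter_union_compl]
      exact (disjoint_compl_right.inf_left _).inf_right _
    have nn : ∀ C, MeasurableSet C → 0 ≤ s (i ∩ C) := fun C hC =>
      (VectorMeasure.restrict_le_restrict_iff _ _ hi).1 h1 (hi.inter hC) Set.inter_subset_left
    have np : ∀ C, MeasurableSet C → s (iᶜ ∩ C) ≤ 0 := fun C hC =>
      (VectorMeasure.restrict_le_restrict_iff _ _ hi.compl).1 h2 (hi.compl.inter hC)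
        Set.inter_subset_left
    have e2 : s i = s (i ∩ B) + s (i ∩ Bᶜ) := by
      rw [← VectorMeasure.of_union _ (hi.inter hB) (hi.inter hB.compl), Set.inter_union_compl]
      exact (disjoint_compl_right.inf_right' _).inf_left' _
    have e3 : s iᶜ = s (iᶜ ∩ B) + s (iᶜ ∩ Bᶜ) := by
      rw [← VectorMeasure.of_union _ (hi.compl.inter hB) (hi.compl.inter hB.compl),
        Set.inter_union_compl]
      exact (disjoint_compl_right.inf_right' _).inf_left' _
    rw [abs_le]
    constructor <;>
      linarith [nn B hB, nn _ hB.compl, np B hB, np _ hB.compl]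

theorem abs_sub_le_tvNorm (μ ν : ProbabilityMeasure S) {B : Set S} (hB : MeasurableSet B) :
    |(μ : Measure S).real B - (ν : Measure S).real B| ≤ tvNorm μ ν :=
  (exists_tvNorm_eq μ ν).choose_spec.2.2 B hB

theorem tvNorm_nonneg (μ ν : ProbabilityMeasure S) : 0 ≤ tvNorm μ ν := measureReal_nonneg

theorem tvNorm_le_of_forall_le_add (μ ν : ProbabilityMeasure S) {e : ℝ≥0∞} (he : e ≠ ∞)
    (h : ∀ B, MeasurableSet B → (ν : Measure S) B ≤ (μ : Measure S) B + e) :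
    tvNorm μ ν ≤ 2 * e.toReal := by
  obtain ⟨I, hI, h1, -⟩ := exists_tvNorm_eq μ ν
  have := ENNReal.toReal_mono (by finiteness) (h I hI)
  rw [ENNReal.toReal_add (by finiteness) he] at this
  rw [h1]
  simp only [Measure.real]
  linarith

end TotalVariation

/-! ### Atoms, the continuous part, and a Scheffé criterion. -/

section Atoms

variable {S : Type*} [MeasurableSpace S] [MeasurableSingletonClass S]

theorem summable_measureReal_singleton (μ : Measure S) [IsFiniteMeasure μ] :
    Summable fun x : S => μ.real {x} := by
  refine ENNReal.summable_toReal (ne_top_of_le_ne_top (measure_ne_top μ Set.univ) ?_)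
  refine tsum_measure_le_measure_univ (fun x => (measurableSet_singleton x).nullMeasurableSet) ?_
  exact fun x y hxy => (Set.disjoint_singleton.2 hxy).aedisjoint

theorem countable_setOf_singleton_ne_zero (μ : Measure S) [SigmaFinite μ] :
    {x : S | μ {x} ≠ 0}.Countable := by
  have h := Measure.countable_meas_pos_of_disjoint_iUnion₀ (μ := μ) (As := fun x : S => {x})
    (fun x => (measurableSet_singleton x).nullMeasurableSet)
    (fun x y hxy => (Set.disjoint_singleton.2 hxy).aedisjoint)
  simpa [pos_iff_ne_zero] using h

theorem le_continuousPart_apply_of_singleton_eq_zero (μ : Measure S) [IsFiniteMeasure μ]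
    {E : Set S} (hE : MeasurableSet E) (h : ∀ x ∈ E, μ {x} = 0) :
    μ E ≤ continuousPart μ E := by
  -- This domination makes the truncated subtraction in `continuousPart` a genuine one.
  have hd : ∀ B, MeasurableSet B → discretePart μ B ≤ μ B := by
    intro B hB
    rw [discretePart, Measure.sum_apply _ hB]
    calc ∑' x, (μ {x} • Measure.dirac x) B ≤ ∑' x, (μ.restrict B) {x} := by
          refine ENNReal.tsum_le_tsum fun x => ?_
          rw [Measure.smul_apply, Measure.dirac_apply' _ hB,
            Measure.restrict_apply (measurableSet_singleton x)]
          by_cases hx : x ∈ B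
          · rw [Set.inter_eq_left.2 (Set.singleton_subset_iff.2 hx)]; simp [hx]
          · simp [hx]
      _ ≤ (μ.restrict B) Set.univ :=
          tsum_measure_le_measure_univ (fun x => (measurableSet_singleton x).nullMeasurableSet)
            (fun x y hxy => (Set.disjoint_singleton.2 hxy).aedisjoint)
      _ = μ B := by simp
  have hle : discretePart μ ≤ μ := Measure.le_iff.2 hd
  have : IsFiniteMeasure (discretePart μ) := isFiniteMeasure_of_le μ hle
  have h0 : discretePart μ E = 0 := by
    rw [discretePart, Measure.sum_apply _ hE, ENNReal.tsum_eq_zero]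
    intro x
    by_cases hx : x ∈ E
    · simp [h x hx]
    · simp [Measure.dirac_apply' _ hE, hx]
  rw [continuousPart, Measure.sub_apply hE hle, h0, tsub_zero]

/-- A Scheffé type criterion: domination from below of the densities of the absolutely continuous
part, plus convergence of the atoms, gives convergence in total variation. -/
theorem tendsto_tvNorm_of_density_of_atoms (μ : ProbabilityMeasure S)
    (μs : ℕ → ProbabilityMeasure S) (ρ : Measure S)
    (f : S → ℝ≥0∞) (g : ℕ → S → ℝ≥0∞) (hf : Measurable f) (hg : ∀ n, Measurable (g n))
    (hfint : ∫⁻ x, f x ∂ρ ≠ ∞)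
    (hμ : ∀ B, MeasurableSet B → (∀ x ∈ B, (μ : Measure S) {x} = 0) →
      (μ : Measure S) B ≤ ∫⁻ x in B, f x ∂ρ)
    (hμs : ∀ n B, MeasurableSet B → ∫⁻ x in B, g n x ∂ρ ≤ (μs n : Measure S) B)
    (hlim : ∀ᵐ x ∂ρ, Tendsto (fun n => f x - g n x) atTop (𝓝 0))
    (hat : ∀ x, Tendsto (fun n => (μs n : Measure S).real {x}) atTop
      (𝓝 ((μ : Measure S).real {x}))) :
    Tendsto (fun n => tvNorm (μs n) μ) atTop (𝓝 0) := by
  set D := {x : S | (μ : Measure S) {x} ≠ 0}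
  have hD : D.Countable := countable_setOf_singleton_ne_zero _
  have hDm : MeasurableSet D := hD.measurableSet
  have hint : Tendsto (fun n => ∫⁻ x, (f x - g n x) ∂ρ) atTop (𝓝 0) := by
    have := tendsto_lintegral_of_dominated_convergence f (μ := ρ) (F := fun n x => f x - g n x)
      (f := fun _ => 0) (fun n => hf.sub (hg n))
      (fun n => ae_of_all _ fun x => tsub_le_self) hfint hlim
    simpa using this
  have hsum : Tendsto (fun n => ∑' x : S, ((μ : Measure S) {x} - (μs n : Measure S) {x}))
      atTop (𝓝 0) := by
    -- Dominated convergence for series is applied to real terms, with dominating sequence `μ{x}`;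
    -- `max _ 0` mirrors the truncated subtraction.
    have hr : Tendsto (fun n => ∑' x : S, max ((μ : Measure S).real {x} -
        (μs n : Measure S).real {x}) 0) atTop (𝓝 (∑' _ : S, (0 : ℝ))) := by
      refine tendsto_tsum_of_dominated_convergence
        (summable_measureReal_singleton (μ : Measure S)) (fun x => ?_)
        (Eventually.of_forall fun n x => ?_)
      · have := ((hat x).const_sub ((μ : Measure S).real {x})).max
          (tendsto_const_nhds (x := (0 : ℝ)))
        simpa using this
      · rw [Real.norm_of_nonneg (le_max_right _ _)]
        exact max_le (sub_le_self _ measureReal_nonneg) measureReal_nonneg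
    rw [tsum_zero] at hr
    have ho := ENNReal.tendsto_ofReal hr
    rw [ENNReal.ofReal_zero] at ho
    refine ho.congr fun n => ?_
    rw [ENNReal.ofReal_tsum_of_nonneg (fun x => le_max_right _ _)]
    · refine tsum_congr fun x => ?_
      rw [ENNReal.ofReal_max, ENNReal.ofReal_sub _ measureReal_nonneg]
      simp
    · refine Summable.of_nonneg_of_le (fun x => le_max_right _ _) (fun x => ?_)
        (summable_measureReal_singleton (μ : Measure S))
      exact max_le (sub_le_self _ measureReal_nonneg) measureReal_nonneg
  -- The error is uniform in `B`: off `D` the densities are compared, on the countable `D` the point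
  -- masses.
  have key : ∀ n B, MeasurableSet B → (μ : Measure S) B ≤ (μs n : Measure S) B +
      (∫⁻ x, (f x - g n x) ∂ρ + ∑' x : S, ((μ : Measure S) {x} - (μs n : Measure S) {x})) := by
    intro n B hB
    have a1 : (μ : Measure S) (B \ D) ≤
        (μs n : Measure S) (B \ D) + ∫⁻ x, (f x - g n x) ∂ρ := by
      calc (μ : Measure S) (B \ D) ≤ ∫⁻ x in B \ D, f x ∂ρ :=
            hμ _ (hB.diff hDm) fun x hx => by simpa [D] using hx.2
        _ ≤ ∫⁻ x in B \ D, (g n x + (f x - g n x)) ∂ρ :=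
            lintegral_mono fun x => le_add_tsub
        _ = ∫⁻ x in B \ D, g n x ∂ρ + ∫⁻ x in B \ D, (f x - g n x) ∂ρ :=
            lintegral_add_left (hg n) _
        _ ≤ _ := add_le_add (hμs n _ (hB.diff hDm)) (setLIntegral_le_lintegral _ _)
    have a2 : (μ : Measure S) (B ∩ D) ≤ (μs n : Measure S) (B ∩ D) +
        ∑' x : S, ((μ : Measure S) {x} - (μs n : Measure S) {x}) := by
      have hc : (B ∩ D).Countable := hD.mono Set.inter_subset_right
      have e : ∀ ν : Measure S, ν (B ∩ D) = ∑' x : ↥(B ∩ D), ν {(x : S)} := by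
        intro ν
        exact (tsum_measure_preimage_singleton (f := id) hc
          fun x _ => measurableSet_singleton x).symm
      rw [e, e]
      calc ∑' x : ↥(B ∩ D), (μ : Measure S) {(x : S)}
          ≤ ∑' x : ↥(B ∩ D), ((μs n : Measure S) {(x : S)} +
            ((μ : Measure S) {(x : S)} - (μs n : Measure S) {(x : S)})) :=
            ENNReal.tsum_le_tsum fun x => le_add_tsub
        _ = _ := ENNReal.tsum_add
        _ ≤ _ := by
            gcongr
            exact ENNReal.tsum_comp_le_tsum_of_injective Subtype.val_injective _
    rw [← measure_sdiff_add_inter B hDm, ← measure_sdiff_add_inter (μ := (μs n : Measure S)) B hDm]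
    calc _ ≤ _ := add_le_add a1 a2
      _ = _ := by ring
  have hlimit := hint.add hsum
  rw [add_zero] at hlimit
  have hfin : ∀ᶠ n in atTop, (∫⁻ x, (f x - g n x) ∂ρ +
      ∑' x : S, ((μ : Measure S) {x} - (μs n : Measure S) {x})) ≠ ∞ := by
    filter_upwards [hlimit.eventually (gt_mem_nhds ENNReal.zero_lt_top)] with n hn using hn.ne
  have h2 := ((ENNReal.tendsto_toReal ENNReal.zero_ne_top).comp hlimit).const_mul 2
  simp only [ENNReal.toReal_zero, mul_zero] at h2
  refine tendsto_of_tendsto_of_tendsto_of_le_of_le' tendsto_const_nhds h2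
    (Eventually.of_forall fun n => tvNorm_nonneg _ _) ?_
  filter_upwards [hfin] with n hn
  exact tvNorm_le_of_forall_le_add _ _ hn (key n)

end Atoms

/-! ### The observation filtration and random measures as kernels. -/

theorem measurable_obsSigma_firstObs {Ω S : Type*} [MeasurableSpace S] (X : ℕ → Ω → S)
    {n m : ℕ} (h : n ≤ m) :
    Measurable[obsSigma X m] (firstObs X n) := by
  have : firstObs X n = (fun (v : Fin m → S) (i : Fin n) => v (Fin.castLE h i)) ∘ firstObs X m := by
    ext ω i; rfl
  rw [this]
  exact (measurable_pi_lambda _ fun i => measurable_pi_apply _).comp (comap_measurable _)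

theorem measurable_iSup_obsSigma {Ω S : Type*} [MeasurableSpace S] (X : ℕ → Ω → S) :
    Measurable[⨆ n, obsSigma X n] fun ω i => X i ω := by
  refine @measurable_pi_lambda _ _ _ (⨆ n, obsSigma X n) _ _ fun i => ?_
  have h : Measurable[obsSigma X (i + 1)] (X i) :=
    (measurable_pi_apply (Fin.last i)).comp (comap_measurable (firstObs X (i + 1)))
  exact h.mono (le_iSup (obsSigma X) (i + 1)) le_rfl

section Kernels

variable {Ω S : Type*} [MeasurableSpace Ω] [MeasurableSpace S]

/-- A random probability measure as a Markov kernel. -/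
noncomputable def IsRandomProbabilityMeasure.kernel {α : Ω → ProbabilityMeasure S}
    (h : IsRandomProbabilityMeasure α) : Kernel Ω S :=
  ⟨fun ω => (α ω : Measure S), Measure.measurable_of_measurable_coe _ h⟩

theorem IsRandomProbabilityMeasure.kernel_apply {α : Ω → ProbabilityMeasure S}
    (h : IsRandomProbabilityMeasure α) (ω : Ω) : h.kernel ω = (α ω : Measure S) := rfl

instance {α : Ω → ProbabilityMeasure S} (h : IsRandomProbabilityMeasure α) :
    IsMarkovKernel h.kernel :=
  ⟨fun ω => (α ω).2⟩

theorem measurable_firstObs {X : ℕ → Ω → S} (hX : ∀ n, Measurable (X n)) (n : ℕ) :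
    Measurable (firstObs X n) :=
  measurable_pi_lambda _ fun i => hX i

/-- The filtration generated by the observations. -/
def obsFiltration {X : ℕ → Ω → S} (hX : ∀ n, Measurable (X n)) :
    Filtration ℕ (inferInstance : MeasurableSpace Ω) where
  seq n := obsSigma X n
  mono' _ _ h := (measurable_obsSigma_firstObs X h).comap_le
  le' n := (measurable_firstObs hX n).comap_le

/-- Moving from `m` to `m + 1` is the c.i.d. identity at level `m`, tested on an event that involves
only the first `n` of the `m` coordinates. -/
theorem IsCID.measure_inter_eq {P : Measure Ω} {X : ℕ → Ω → S} (h : IsCID X P)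
    {n : ℕ}
    {A : Set (Fin n → S)} (hA : MeasurableSet A) {B : Set S} (hB : MeasurableSet B) {m : ℕ}
    (hm : n ≤ m) :
    P (firstObs X n ⁻¹' A ∩ X m ⁻¹' B) = P (firstObs X n ⁻¹' A ∩ X n ⁻¹' B) := by
  induction m, hm using Nat.le_induction with
  | base => rfl
  | succ m hm ih =>
    rw [← ih]
    set A' : Set (Fin m → S) := (fun v (i : Fin n) => v (Fin.castLE hm i)) ⁻¹' A
    have hA' : MeasurableSet A' :=
      (measurable_pi_lambda _ fun i => measurable_pi_apply _) hA
    exact (h m).measure_mem_eq (hA'.prod hB)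

end Kernels

/-! ### Predictive measures and the limit as functions of the observations. -/

section Setup

variable {Ω S : Type*} [MeasurableSpace Ω] [TopologicalSpace S] [PolishSpace S]
  [MeasurableSpace S] [BorelSpace S] [Nonempty S]
  {P : Measure Ω} [IsProbabilityMeasure P] {X : ℕ → Ω → S}
  {αₙ : ℕ → Ω → ProbabilityMeasure S} {α : Ω → ProbabilityMeasure S}

/-- `αₙ n` is only required to be measurable for the ambient sigma-field; this replaces it by a
genuine kernel in the first `n` observations, outside one null set for all `B`. -/
theorem IsPredictiveSequence.ae_eq_condDistrib (hαₙ : IsPredictiveSequence αₙ X P)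
    (hX : ∀ n, Measurable (X n)) (n : ℕ) :
    ∀ᵐ ω ∂P, (αₙ n ω : Measure S) = condDistrib (X n) (firstObs X n) P (firstObs X n ω) := by
  have hm := measurable_firstObs hX n
  have := kernel_ae_eq_of_forall_ae_eq_apply (P := P) (κ := (hαₙ n).1.kernel)
    (η := (condDistrib (X n) (firstObs X n) P).comap _ hm) fun B hB => by
      filter_upwards [(hαₙ n).2 B hB, condDistrib_ae_eq_condExp hm (hX n) hB (μ := P)]
        with ω h1 h2
      rw [Kernel.comap_apply, IsRandomProbabilityMeasure.kernel_apply]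
      rw [← h2] at h1
      exact (measureReal_eq_measureReal_iff).1 h1
  filter_upwards [this] with ω h using h

/-- The joint law of the first `n` observations and the next one, through `αₙ`. -/
theorem IsPredictiveSequence.lintegral_eq (hαₙ : IsPredictiveSequence αₙ X P)
    (hX : ∀ n, Measurable (X n)) (n : ℕ) {h : (Fin n → S) × S → ℝ≥0∞} (hh : Measurable h) :
    ∫⁻ ω, ∫⁻ y, h (firstObs X n ω, y) ∂(αₙ n ω : Measure S) ∂P
      = ∫⁻ ω, h (firstObs X n ω, X n ω) ∂P := by
  have hm := measurable_firstObs hX n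
  calc _ = ∫⁻ ω, ∫⁻ y, h (firstObs X n ω, y)
        ∂(condDistrib (X n) (firstObs X n) P (firstObs X n ω)) ∂P :=
        lintegral_congr_ae (by
          filter_upwards [hαₙ.ae_eq_condDistrib hX n] with ω hω
          rw [hω])
    _ = ∫⁻ v, ∫⁻ y, h (v, y) ∂(condDistrib (X n) (firstObs X n) P v) ∂(P.map (firstObs X n)) := by
        rw [lintegral_map _ hm]
        exact hh.lintegral_kernel_prod_right'
    _ = ∫⁻ p, h p ∂(P.map fun ω => (firstObs X n ω, X n ω)) := by
        rw [← compProd_map_condDistrib (hX n).aemeasurable, Measure.lintegral_compProd hh]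
    _ = _ := lintegral_map hh (hm.prodMk (hX n))

/-- The limit is almost surely a measurable function of the observations. -/
theorem IsPredictiveSequence.exists_measurable_ae_eq_apply (hαₙ : IsPredictiveSequence αₙ X P)
    (hX : ∀ n, Measurable (X n))
    (hlim : ∀ᵐ ω ∂P, Tendsto (fun n => αₙ n ω) atTop (𝓝 (α ω))) {B : Set S}
    (hB : MeasurableSet B) :
    ∃ h : (ℕ → S) → ℝ≥0∞, Measurable h ∧ ∀ᵐ ω ∂P, (α ω : Measure S) B = h fun i => X i ω := by
  have hcont : ∀ g : BoundedContinuousFunction S ℝ≥0, ∃ h : (ℕ → S) → ℝ≥0∞, Measurable h ∧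
      ∀ᵐ ω ∂P, ∫⁻ y, g y ∂(α ω : Measure S) = h fun i => X i ω := by
    intro g
    have hg : Measurable fun y => (g y : ℝ≥0∞) := g.continuous.measurable.coe_nnreal_ennreal
    -- A limsup is measurable without any convergence and equals the limit wherever there is one.
    refine ⟨fun x => limsup (fun n => ∫⁻ y, g y
      ∂(condDistrib (X n) (firstObs X n) P fun i : Fin n => x i)) atTop, ?_, ?_⟩
    · refine Measurable.limsup fun n => ?_
      exact (hg.lintegral_kernel (κ := condDistrib (X n) (firstObs X n) P)).comp
        (measurable_pi_lambda _ fun i => measurable_pi_apply _)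
    · filter_upwards [hlim, ae_all_iff.2 fun n => hαₙ.ae_eq_condDistrib hX n] with ω h1 h2
      have h3 := (ProbabilityMeasure.tendsto_iff_forall_lintegral_tendsto.1 h1 g).limsup_eq
      rw [← h3]
      simp only [h2]
      rfl
  induction B, hB using MeasurableSpace.induction_on_inter
    ((BorelSpace.measurable_eq (α := S)).trans borel_eq_generateFrom_isClosed)
    isPiSystem_isClosed with
  | empty => exact ⟨fun _ => 0, measurable_const, by simp⟩
  | basic F hF =>
    have hF : IsClosed F := hF
    choose h hm hae using fun k => hcont (hF.apprSeq k)
    refine ⟨fun x => limsup (fun k => h k x) atTop, Measurable.limsup hm, ?_⟩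
    filter_upwards [ae_all_iff.2 hae] with ω h1
    rw [← (HasOuterApproxClosed.tendsto_lintegral_apprSeq hF (α ω : Measure S)).limsup_eq]
    simp only [h1]
  | compl B hB ih =>
    obtain ⟨h, hm, hae⟩ := ih
    refine ⟨fun x => 1 - h x, measurable_const.sub hm, ?_⟩
    filter_upwards [hae] with ω hω
    rw [prob_compl_eq_one_sub hB, hω]
  | iUnion f hd hf ih =>
    choose h hm hae using ih
    refine ⟨fun x => ∑' k, h k x, Measurable.tsum hm, ?_⟩
    filter_upwards [ae_all_iff.2 hae] with ω hω
    rw [measure_iUnion hd hf]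
    simp only [hω]

/-- The limit is almost surely given by a kernel evaluated at the observations. -/
theorem IsPredictiveSequence.exists_kernel_ae_eq (hαₙ : IsPredictiveSequence αₙ X P)
    (hX : ∀ n, Measurable (X n)) (hα : IsRandomProbabilityMeasure α)
    (hlim : ∀ᵐ ω ∂P, Tendsto (fun n => αₙ n ω) atTop (𝓝 (α ω))) :
    ∃ κ : Kernel (ℕ → S) S, IsMarkovKernel κ ∧
      ∀ᵐ ω ∂P, (α ω : Measure S) = κ fun i => X i ω := by
  have hXm : Measurable fun ω i => X i ω := measurable_pi_lambda _ hX
  set Q := P.map fun ω i => X i ω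
  have : IsProbabilityMeasure Q := Measure.isProbabilityMeasure_map hXm.aemeasurable
  -- Joint law of the whole sequence and a draw from `α`. Its conditional kernel recovers `α`
  -- itself, and not merely an average, because each `α(B)` is already a function of the sequence.
  set R := (P ⊗ₘ hα.kernel).map (Prod.map (fun ω i => X i ω) id)
  have hm : Measurable (Prod.map (fun ω i => X i ω) id : Ω × S → (ℕ → S) × S) :=
    hXm.prodMap measurable_id
  have hRapp : ∀ {s : Set (ℕ → S)} {B : Set S}, MeasurableSet s → MeasurableSet B →
      R (s ×ˢ B) = ∫⁻ ω in (fun ω i => X i ω) ⁻¹' s, (α ω : Measure S) B ∂P := by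
    intro s B hs hB
    rw [Measure.map_apply hm (hs.prod hB), Set.preimage_prod_map_prod,
      Measure.compProd_apply_prod (hXm hs) (measurable_id hB)]
    rfl
  have : IsProbabilityMeasure R := Measure.isProbabilityMeasure_map hm.aemeasurable
  have hfst : R.fst = Q := by
    ext s hs
    rw [Measure.fst_apply hs, ← Set.prod_univ, hRapp hs MeasurableSet.univ,
      Measure.map_apply hXm hs]
    simp
  refine ⟨R.condKernel, inferInstance, ?_⟩
  have := kernel_ae_eq_of_forall_ae_eq_apply (P := P) (κ := hα.kernel)
    (η := R.condKernel.comap _ hXm) fun B hB => by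
      obtain ⟨h, hh, hae⟩ := hαₙ.exists_measurable_ae_eq_apply hX hlim hB
      have h1 : (fun x => R.condKernel x B) =ᵐ[Q] h := by
        refine ae_eq_of_forall_setLIntegral_eq_of_sigmaFinite
          (Kernel.measurable_coe _ hB) hh fun s hs _ => ?_
        have := hRapp hs hB
        rw [← R.disintegrate R.condKernel, Measure.compProd_apply_prod hs hB, hfst] at this
        rw [this, setLIntegral_map hs hh hXm]
        exact lintegral_congr_ae (ae_restrict_of_ae hae)
      filter_upwards [hae, ae_of_ae_map hXm.aemeasurable h1] with ω h2 h3
      rw [Kernel.comap_apply, IsRandomProbabilityMeasure.kernel_apply, h2, h3]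
  filter_upwards [this] with ω h using h

/-- The joint law of the first `n` observations and a draw from the limit. -/
theorem IsCID.lintegral_eq (h : IsCID X P) (hαₙ : IsPredictiveSequence αₙ X P)
    (hX : ∀ n, Measurable (X n)) (hα : IsRandomProbabilityMeasure α)
    (hlim : ∀ᵐ ω ∂P, Tendsto (fun n => αₙ n ω) atTop (𝓝 (α ω))) (n : ℕ)
    {f : (Fin n → S) × S → ℝ≥0∞} (hf : Measurable f) :
    ∫⁻ ω, ∫⁻ y, f (firstObs X n ω, y) ∂(α ω : Measure S) ∂P
      = ∫⁻ ω, f (firstObs X n ω, X n ω) ∂P := by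
  have hm := measurable_firstObs hX n
  have hrect : ∀ A : Set (Fin n → S), MeasurableSet A →
      (P.restrict (firstObs X n ⁻¹' A)).bind hα.kernel
        = (P.restrict (firstObs X n ⁻¹' A)).map (X n) := by
    intro A hA
    -- The averaged measure does not depend on `m ≥ n`, so bounded convergence of integrals of
    -- continuous functions passes the identity to `α`.
    have hmarg : ∀ m, n ≤ m → (P.restrict (firstObs X n ⁻¹' A)).bind (hαₙ m).1.kernel
        = (P.restrict (firstObs X n ⁻¹' A)).map (X n) := by
      intro m hnm
      ext B hB
      rw [Measure.bind_apply hB (Kernel.aemeasurable _), Measure.map_apply (hX n) hB,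
        Measure.restrict_apply (hX n hB), Set.inter_comm, ← h.measure_inter_eq hA hB hnm]
      set A' : Set (Fin m → S) := (fun v (i : Fin n) => v (Fin.castLE hnm i)) ⁻¹' A
      have hA' : MeasurableSet A' :=
        (measurable_pi_lambda _ fun i => measurable_pi_apply _) hA
      have := hαₙ.lintegral_eq hX m (h := (A' ×ˢ B).indicator 1)
        (measurable_one.indicator (hA'.prod hB))
      have e1 : ∀ ω y, (A' ×ˢ B).indicator (1 : (Fin m → S) × S → ℝ≥0∞) (firstObs X m ω, y)
          = (firstObs X n ⁻¹' A).indicator 1 ω * B.indicator 1 y := by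
        intro ω y
        rw [Set.indicator_prod_one]
        rfl
      have e2 : ∀ ω, (A' ×ˢ B).indicator (1 : (Fin m → S) × S → ℝ≥0∞) (firstObs X m ω, X m ω)
          = (firstObs X n ⁻¹' A ∩ X m ⁻¹' B).indicator (1 : Ω → ℝ≥0∞) ω := fun ω => rfl
      simp_rw [e2, lintegral_indicator_one ((hm hA).inter (hX m hB)), e1] at this
      rw [← this, ← lintegral_indicator (hm hA)]
      refine lintegral_congr fun ω => ?_
      rw [lintegral_const_mul _ (measurable_one.indicator hB), lintegral_indicator_one hB]
      by_cases hω : ω ∈ firstObs X n ⁻¹' A <;>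
        simp [hω, IsRandomProbabilityMeasure.kernel_apply]
    refine ext_of_forall_lintegral_eq_of_IsFiniteMeasure fun g => ?_
    have hg : Measurable fun y => (g y : ℝ≥0∞) := g.continuous.measurable.coe_nnreal_ennreal
    rw [Measure.lintegral_bind (Kernel.aemeasurable _) hg.aemeasurable]
    have ht : Tendsto (fun m => ∫⁻ ω in firstObs X n ⁻¹' A, ∫⁻ y, g y ∂(hαₙ m).1.kernel ω ∂P)
        atTop (𝓝 (∫⁻ ω in firstObs X n ⁻¹' A, ∫⁻ y, g y ∂hα.kernel ω ∂P)) := by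
      refine tendsto_lintegral_of_dominated_convergence (fun _ => (nndist g 0 : ℝ≥0∞))
        (fun m => hg.lintegral_kernel) (fun m => ae_of_all _ fun ω => ?_) ?_ ?_
      · refine (lintegral_mono (g := fun _ => (nndist g 0 : ℝ≥0∞)) fun y => ?_).trans_eq ?_
        · exact ENNReal.coe_le_coe.2 (BoundedContinuousFunction.NNReal.upper_bound g y)
        · simp
      · rw [lintegral_const]
        finiteness
      · filter_upwards [ae_restrict_of_ae hlim] with ω hω
        exact ProbabilityMeasure.tendsto_iff_forall_lintegral_tendsto.1 hω g
    refine tendsto_nhds_unique ht (tendsto_const_nhds.congr' ?_)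
    filter_upwards [eventually_ge_atTop n] with m hnm
    rw [← hmarg m hnm, Measure.lintegral_bind (Kernel.aemeasurable _) hg.aemeasurable]
  have hlaw : (P ⊗ₘ hα.kernel).map (Prod.map (firstObs X n) id)
      = P.map fun ω => (firstObs X n ω, X n ω) := by
    have hm2 : Measurable (Prod.map (firstObs X n) id : Ω × S → _ × S) :=
      hm.prodMap measurable_id
    have : IsProbabilityMeasure ((P ⊗ₘ hα.kernel).map (Prod.map (firstObs X n) id)) :=
      Measure.isProbabilityMeasure_map hm2.aemeasurable
    refine Measure.ext_prod fun {A B} hA hB => ?_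
    have h1 := congrArg (fun ν => ν B) (hrect A hA)
    simp only [Measure.bind_apply hB (Kernel.aemeasurable _), Measure.map_apply (hX n) hB,
      Measure.restrict_apply (hX n hB)] at h1
    rw [Measure.map_apply hm2 (hA.prod hB), Set.preimage_prod_map_prod,
      Measure.compProd_apply_prod (hm hA) (measurable_id hB),
      Measure.map_apply (hm.prodMk (hX n)) (hA.prod hB), Set.mk_preimage_prod, Set.inter_comm]
    exact h1
  rw [← lintegral_map hf (hm.prodMk (hX n)), ← hlaw,
    lintegral_map hf (hm.prodMap measurable_id), Measure.lintegral_compProd]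
  · rfl
  · exact hf.comp (hm.prodMap measurable_id)

end Setup

/-! ### Martingale convergence on random sets. -/

section

theorem IsRandomProbabilityMeasure.measurable_apply_section {Ω S T : Type*} [MeasurableSpace Ω]
    [MeasurableSpace S] [MeasurableSpace T] {α : Ω → ProbabilityMeasure S}
    (hα : IsRandomProbabilityMeasure α) {Z : Ω → T} (hZ : Measurable Z) {D : Set (T × S)}
    (hD : MeasurableSet D) : Measurable fun ω => (α ω : Measure S) (Prod.mk (Z ω) ⁻¹' D) :=
  Kernel.measurable_kernel_prodMk_left (κ := hα.kernel) ((hZ.prodMap measurable_id) hD)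

variable {Ω S : Type*} [MeasurableSpace Ω] [TopologicalSpace S] [PolishSpace S]
  [MeasurableSpace S] [BorelSpace S] [Nonempty S]
  {P : Measure Ω} [IsProbabilityMeasure P] {X : ℕ → Ω → S}
  {αₙ : ℕ → Ω → ProbabilityMeasure S} {α : Ω → ProbabilityMeasure S}

theorem IsPredictiveSequence.lintegral_apply_eq (hαₙ : IsPredictiveSequence αₙ X P)
    (hX : ∀ n, Measurable (X n)) (n : ℕ) {E : Set ((Fin n → S) × S)} (hE : MeasurableSet E) :
    ∫⁻ ω, (αₙ n ω : Measure S) (Prod.mk (firstObs X n ω) ⁻¹' E) ∂P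
      = P {ω | (firstObs X n ω, X n ω) ∈ E} := by
  have h := hαₙ.lintegral_eq hX n (h := E.indicator 1) (measurable_one.indicator hE)
  have hE' : MeasurableSet {ω | (firstObs X n ω, X n ω) ∈ E} :=
    ((measurable_firstObs hX n).prodMk (hX n)) hE
  rw [← lintegral_indicator_one hE']
  refine Eq.trans (lintegral_congr fun ω => ?_) h
  exact (lintegral_indicator_one (measurable_prodMk_left hE)).symm

/-- The right-hand side is the one obtained for `αₙ n`; equating the two is the martingale identity
used below. -/
theorem IsCID.lintegral_apply_eq (h : IsCID X P) (hαₙ : IsPredictiveSequence αₙ X P)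
    (hX : ∀ n, Measurable (X n)) (hα : IsRandomProbabilityMeasure α)
    (hlim : ∀ᵐ ω ∂P, Tendsto (fun n => αₙ n ω) atTop (𝓝 (α ω))) (n : ℕ)
    {E : Set ((Fin n → S) × S)} (hE : MeasurableSet E) :
    ∫⁻ ω, (α ω : Measure S) (Prod.mk (firstObs X n ω) ⁻¹' E) ∂P
      = P {ω | (firstObs X n ω, X n ω) ∈ E} := by
  have h := h.lintegral_eq hαₙ hX hα hlim n (f := E.indicator 1) (measurable_one.indicator hE)
  have hE' : MeasurableSet {ω | (firstObs X n ω, X n ω) ∈ E} :=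
    ((measurable_firstObs hX n).prodMk (hX n)) hE
  rw [← lintegral_indicator_one hE']
  refine Eq.trans (lintegral_congr fun ω => ?_) h
  exact (lintegral_indicator_one (measurable_prodMk_left hE)).symm

/-- Predictive probabilities of a set depending on finitely many observations converge. -/
theorem IsCID.tendsto_measureReal_section (h : IsCID X P) (hαₙ : IsPredictiveSequence αₙ X P)
    (hX : ∀ n, Measurable (X n)) (hα : IsRandomProbabilityMeasure α)
    (hlim : ∀ᵐ ω ∂P, Tendsto (fun n => αₙ n ω) atTop (𝓝 (α ω))) (N : ℕ)
    {D : Set ((Fin N → S) × S)} (hD : MeasurableSet D) :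
    ∀ᵐ ω ∂P, Tendsto (fun n => (αₙ n ω : Measure S).real (Prod.mk (firstObs X N ω) ⁻¹' D)) atTop
      (𝓝 ((α ω : Measure S).real (Prod.mk (firstObs X N ω) ⁻¹' D))) := by
  obtain ⟨κ, hκ, hακ⟩ := hαₙ.exists_kernel_ae_eq hX hα hlim
  set Ψ : (ℕ → S) → ℝ := fun x => (κ x).real (Prod.mk (fun i : Fin N => x i) ⁻¹' D)
  have hΨ : Measurable Ψ := by
    have hp : Measurable fun p : (ℕ → S) × S => ((fun i : Fin N => p.1 i), p.2) :=
      (measurable_pi_lambda _ fun i => (measurable_pi_apply _).comp measurable_fst).prodMk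
        measurable_snd
    exact (Kernel.measurable_kernel_prodMk_left (κ := κ) (hp hD)).ennreal_toReal
  have hXm : Measurable fun ω i => X i ω := measurable_pi_lambda _ hX
  have hgi : Integrable (fun ω => Ψ fun i => X i ω) P := by
    refine Integrable.of_bound (hΨ.comp hXm).aestronglyMeasurable 1 (ae_of_all _ fun ω => ?_)
    rw [Real.norm_of_nonneg measureReal_nonneg]
    exact measureReal_le_one
  -- Passing from `α` to `κ` supplies the measurability with respect to all observations that Lévy's
  -- theorem needs.
  have hlevy := hgi.tendsto_ae_condExp (ℱ := obsFiltration hX)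
    (hΨ.comp (measurable_iSup_obsSigma X)).stronglyMeasurable
  have hcond : ∀ n, N ≤ n → (fun ω => (αₙ n ω : Measure S).real
      (Prod.mk (firstObs X N ω) ⁻¹' D)) =ᵐ[P]
        P[fun ω => Ψ fun i => X i ω | obsFiltration hX n] := by
    intro n hn
    set r : (Fin n → S) × S → (Fin N → S) × S := fun p => ((fun i => p.1 (Fin.castLE hn i)), p.2)
    have hr : Measurable r :=
      (measurable_pi_lambda _ fun i => (measurable_pi_apply _).comp measurable_fst).prodMk
        measurable_snd
    have hm := measurable_firstObs hX n
    set Φ : (Fin n → S) → ℝ := fun v =>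
      (condDistrib (X n) (firstObs X n) P v).real (Prod.mk v ⁻¹' (r ⁻¹' D))
    have hΦ : Measurable Φ :=
      (Kernel.measurable_kernel_prodMk_left (κ := condDistrib (X n) (firstObs X n) P)
        (hr hD)).ennreal_toReal
    have hae : (fun ω => (αₙ n ω : Measure S).real (Prod.mk (firstObs X N ω) ⁻¹' D)) =ᵐ[P]
        fun ω => Φ (firstObs X n ω) := by
      filter_upwards [hαₙ.ae_eq_condDistrib hX n] with ω hω
      rw [hω]
      rfl
    refine hae.trans (ae_eq_condExp_of_forall_setIntegral_eq ((obsFiltration hX).le n) hgi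
      (fun s _ _ => ?_) (fun s hs _ => ?_) ?_)
    · refine (Integrable.of_bound (hΦ.comp hm).aestronglyMeasurable 1
        (ae_of_all _ fun ω => ?_)).integrableOn
      simp only [Function.comp_apply, Φ]
      rw [Real.norm_of_nonneg measureReal_nonneg]
      exact measureReal_le_one
    · obtain ⟨A, hA, rfl⟩ := hs
      -- The conditioning event is absorbed into the random set, whose section is empty off that
      -- event.
      have hset : ∀ β : Ω → Measure S,
          ∫⁻ ω in firstObs X n ⁻¹' A, β ω (Prod.mk (firstObs X N ω) ⁻¹' D) ∂P
          = ∫⁻ ω, β ω (Prod.mk (firstObs X n ω) ⁻¹' (Prod.fst ⁻¹' A ∩ r ⁻¹' D)) ∂P := by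
        intro β
        rw [← lintegral_indicator (hm hA)]
        refine lintegral_congr fun ω => ?_
        by_cases hω : firstObs X n ω ∈ A
        · rw [Set.indicator_of_mem (show ω ∈ firstObs X n ⁻¹' A from hω)]
          congr 1
          ext y
          simp only [Set.mem_preimage, Set.mem_inter_iff, hω, true_and]
          rfl
        · rw [Set.indicator_of_notMem (show ω ∉ firstObs X n ⁻¹' A from hω)]
          symm
          convert measure_empty (μ := β ω)
          ext y
          simp [hω]
      have hE : MeasurableSet (Prod.fst ⁻¹' A ∩ r ⁻¹' D) := (measurable_fst hA).inter (hr hD)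
      have e1 : ∫⁻ ω in firstObs X n ⁻¹' A, (αₙ n ω : Measure S) (Prod.mk (firstObs X N ω) ⁻¹' D) ∂P
          = ∫⁻ ω in firstObs X n ⁻¹' A, (α ω : Measure S) (Prod.mk (firstObs X N ω) ⁻¹' D) ∂P := by
        rw [hset, hset, hαₙ.lintegral_apply_eq hX n hE, h.lintegral_apply_eq hαₙ hX hα hlim n hE]
      have e2 : ∫ ω in firstObs X n ⁻¹' A, Φ (firstObs X n ω) ∂P
          = (∫⁻ ω in firstObs X n ⁻¹' A, (αₙ n ω : Measure S)
              (Prod.mk (firstObs X N ω) ⁻¹' D) ∂P).toReal := by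
        rw [← integral_toReal]
        · exact integral_congr_ae (ae_restrict_of_ae hae.symm)
        · exact ((hαₙ n).1.measurable_apply_section (measurable_firstObs hX N) hD).aemeasurable
        · exact ae_of_all _ fun ω => measure_lt_top _ _
      have e3 : ∫ ω in firstObs X n ⁻¹' A, Ψ (fun i => X i ω) ∂P
          = (∫⁻ ω in firstObs X n ⁻¹' A, (α ω : Measure S)
              (Prod.mk (firstObs X N ω) ⁻¹' D) ∂P).toReal := by
        rw [← integral_toReal]
        · refine integral_congr_ae (ae_restrict_of_ae ?_)
          filter_upwards [hακ] with ω hω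
          rw [hω]
          rfl
        · exact (hα.measurable_apply_section (measurable_firstObs hX N) hD).aemeasurable
        · exact ae_of_all _ fun ω => measure_lt_top _ _
      rw [e2, e3, e1]
    · exact (hΦ.comp (comap_measurable (firstObs X n))).stronglyMeasurable.aestronglyMeasurable
  filter_upwards [hlevy, hακ, ae_all_iff.2 fun n => ae_all_iff.2 (hcond n)] with ω h1 h2 h3
  have h4 : (α ω : Measure S).real (Prod.mk (firstObs X N ω) ⁻¹' D) = Ψ fun i => X i ω := by
    rw [h2]; rfl
  rw [h4]
  refine h1.congr' ?_
  filter_upwards [eventually_ge_atTop N] with n hn using (h3 n hn).symm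

end

/-! ### Exchangeability: ties and conditional independence. -/

section

section Exchangeable

variable {Ω S : Type*} [MeasurableSpace Ω] [MeasurableSpace S] {P : Measure Ω} {X : ℕ → Ω → S}

/-- Finitely many distinct indices fit below some `N`, and a partial injection of a finite set
extends to a permutation. -/
theorem IsExchangeable.identDistrib_of_injective (h : IsExchangeable X P) {r : ℕ} {j : Fin r → ℕ}
    (hj : Function.Injective j) :
    IdentDistrib (fun ω i => X (j i) ω) (firstObs X r) P P := by
  obtain ⟨N, hN⟩ : ∃ N, r ≤ N ∧ ∀ i, j i < N := by
    refine ⟨max r (Finset.univ.sup j + 1), le_max_left _ _, fun i => lt_max_of_lt_right ?_⟩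
    exact Nat.lt_succ_of_le (Finset.le_sup (Finset.mem_univ i))
  obtain ⟨σ, hσ⟩ := Equiv.Perm.exists_extending_pair (Fin.castLE hN.1)
    (fun i => (⟨j i, hN.2 i⟩ : Fin N)) (Fin.castLE_injective hN.1)
    (fun a b hab => hj (by simpa using hab))
  have := (h N σ).comp (u := fun (v : Fin N → S) i => v (Fin.castLE hN.1 i))
    (measurable_pi_lambda _ fun i => measurable_pi_apply _)
  convert this using 1
  · ext ω i
    simp [hσ]
  · rfl

theorem IsExchangeable.identDistrib_pair_shift (h : IsExchangeable X P) {n k : ℕ} (hk : n ≤ k) :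
    IdentDistrib (fun ω => (firstObs X n ω, X k ω, X (k + 1) ω))
      (fun ω => (firstObs X n ω, X n ω, X (n + 1) ω)) P P := by
  have := (h.identDistrib_of_injective (r := n + 2)
    (j := fun i => if (i : ℕ) < n then i else i + (k - n))
    (fun a b hab => by ext; grind)).comp
    (u := fun v : Fin (n + 2) → S =>
      ((fun i : Fin n => v (i.castAdd 2)), v ⟨n, by omega⟩, v ⟨n + 1, by omega⟩))
    ((measurable_pi_lambda _ fun i => measurable_pi_apply _).prodMk
      ((measurable_pi_apply _).prodMk (measurable_pi_apply _)))
  convert this using 1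
  · ext ω : 1
    refine Prod.ext ?_ (Prod.ext ?_ ?_)
    · ext i
      simp [firstObs]
    · simp only [Function.comp_apply]
      grind
    · simp only [Function.comp_apply]
      grind
  · rfl

theorem IsExchangeable.isCID (h : IsExchangeable X P) : IsCID X P := by
  intro n
  have := (h.identDistrib_of_injective (r := n + 1)
    (j := fun i => if (i : ℕ) < n then i else n + 1)
    (fun a b hab => by ext; grind)).comp
    (u := fun v : Fin (n + 1) → S => ((fun i : Fin n => v i.castSucc), v (Fin.last n)))
    ((measurable_pi_lambda _ fun i => measurable_pi_apply _).prodMk (measurable_pi_apply _))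
  convert this using 1
  · ext ω : 1
    refine Prod.ext ?_ ?_
    · ext i
      simp [firstObs]
    · simp
  · rfl

/-- Let `G l` say that, among the first `n + 1` coordinates, exactly the one at `l` agrees with the
last. These `n + 1` events are disjoint, and equally likely because swapping `l` with `n` fixes the
last coordinate; the event in question lies in `G (Fin.last n)`. -/
theorem IsExchangeable.measure_new_pair_le [IsProbabilityMeasure P] [MeasurableEq S]
    (h : IsExchangeable X P) (hX : ∀ n, Measurable (X n)) (n : ℕ) :
    P {ω | X n ω = X (n + 1) ω ∧ ∀ i : Fin n, X i ω ≠ X n ω} ≤ ((n : ℝ≥0∞) + 1)⁻¹ := by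
  set G : Fin (n + 1) → Set (Fin (n + 2) → S) := fun l =>
    {v | ∀ i : Fin (n + 1), v i.castSucc = v (Fin.last _) ↔ i = l}
  have hG : ∀ l, MeasurableSet (G l) := by
    intro l
    simp only [G, Set.ofPred_forall]
    refine MeasurableSet.iInter fun i => ?_
    have hm : MeasurableSet {v : Fin (n + 2) → S | v i.castSucc = v (Fin.last _)} :=
      measurableSet_eq_fun (measurable_pi_apply _) (measurable_pi_apply _)
    by_cases hi : i = l
    · simpa [hi] using hm
    · simp only [hi, iff_false]
      exact hm.compl
  have hm := measurable_firstObs hX (n + 2)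
  have heq : ∀ l, P (firstObs X (n + 2) ⁻¹' G l) = P (firstObs X (n + 2) ⁻¹' G (Fin.last n)) := by
    intro l
    set τ := Equiv.swap l (Fin.last n)
    have := (h (n + 2) (Equiv.swap l.castSucc (Fin.last n).castSucc)).measure_mem_eq
      (hG (Fin.last n))
    rw [← this]
    congr 1
    ext ω
    simp only [Set.mem_preimage, G, Set.mem_ofPred_eq]
    have e1 : ∀ i : Fin (n + 1), Equiv.swap l.castSucc (Fin.last n).castSucc i.castSucc
        = (τ i).castSucc := fun i => ((Fin.castSucc_injective (n + 1)).swap_apply l (Fin.last n) i)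
    have e2 : Equiv.swap l.castSucc (Fin.last n).castSucc (Fin.last (n + 1)) = Fin.last (n + 1) :=
      Equiv.swap_apply_of_ne_of_ne (Fin.castSucc_lt_last _).ne' (Fin.castSucc_lt_last _).ne'
    simp only [e1, e2]
    have e3 : ∀ i, τ i = l ↔ i = Fin.last n := fun i => by
      rw [← Equiv.eq_symm_apply]; simp [τ]
    constructor
    · intro hω i
      rw [← e3]
      exact hω (τ i)
    · intro hω i
      have := hω (τ i)
      rw [← e3] at this
      rwa [show τ (τ i) = i by simp [τ]] at this
  have hdisj : Pairwise (Function.onFun Disjoint fun l => firstObs X (n + 2) ⁻¹' G l) := by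
    intro l l' hne
    refine Set.disjoint_left.2 fun ω h1 h2 => hne ?_
    exact (h2 l).1 ((h1 l).2 rfl)
  have hsum : ((n : ℝ≥0∞) + 1) * P (firstObs X (n + 2) ⁻¹' G (Fin.last n)) ≤ 1 := by
    calc _ = ∑ l : Fin (n + 1), P (firstObs X (n + 2) ⁻¹' G l) := by
          simp [heq]
      _ = P (⋃ l, firstObs X (n + 2) ⁻¹' G l) := by
          rw [measure_iUnion hdisj fun l => hm (hG l), tsum_fintype]
      _ ≤ 1 := prob_le_one
  rw [ENNReal.le_inv_iff_mul_le, mul_comm]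
  refine le_trans ?_ hsum
  gcongr
  rintro ω ⟨h1, h2⟩ i
  refine Fin.lastCases ?_ (fun i => ?_) i
  · simpa [firstObs] using h1
  · simp only [firstObs, Fin.val_castSucc, Fin.val_last, ← h1]
    simp [h2 i, Fin.castSucc_ne_last]

end Exchangeable

variable {Ω S : Type*} [MeasurableSpace Ω] [TopologicalSpace S] [PolishSpace S]
  [MeasurableSpace S] [BorelSpace S] [Nonempty S]
  {P : Measure Ω} [IsProbabilityMeasure P] {X : ℕ → Ω → S}
  {αₙ : ℕ → Ω → ProbabilityMeasure S} {α : Ω → ProbabilityMeasure S}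

/-- Given the limit, the next two observations behave like two independent draws from it. -/
theorem IsExchangeable.setLIntegral_mul_eq (h : IsExchangeable X P)
    (hαₙ : IsPredictiveSequence αₙ X P)
    (hX : ∀ n, Measurable (X n)) (hα : IsRandomProbabilityMeasure α)
    (hlim : ∀ᵐ ω ∂P, Tendsto (fun n => αₙ n ω) atTop (𝓝 (α ω))) (n : ℕ)
    {A : Set (Fin n → S)} (hA : MeasurableSet A) {B B' : Set S} (hB : MeasurableSet B)
    (hB' : MeasurableSet B') :
    ∫⁻ ω in firstObs X n ⁻¹' A, (α ω : Measure S) B * (α ω : Measure S) B' ∂P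
      = P {ω | firstObs X n ω ∈ A ∧ X n ω ∈ B' ∧ X (n + 1) ω ∈ B} := by
  have hm := measurable_firstObs hX
  set s := firstObs X n ⁻¹' A
  have hs : MeasurableSet s := hm n hA
  set p := P {ω | firstObs X n ω ∈ A ∧ X n ω ∈ B' ∧ X (n + 1) ω ∈ B}
  have hconv : ∀ᵐ ω ∂P, Tendsto (fun k => (αₙ k ω : Measure S).real B) atTop
      (𝓝 ((α ω : Measure S).real B)) :=
    h.isCID.tendsto_measureReal_section hαₙ hX hα hlim 0 (D := Prod.snd ⁻¹' B) (measurable_snd hB)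
  -- `αₙ k (B)` is a function of the first `k` observations, so a draw from `α` may be replaced by
  -- `X k`.
  have step1 : ∀ k, n ≤ k →
      ∫⁻ ω in s, (αₙ k ω : Measure S) B * (α ω : Measure S) B' ∂P
        = ∫⁻ ω in s ∩ X k ⁻¹' B', (αₙ k ω : Measure S) B ∂P := by
    intro k hk
    set A' : Set (Fin k → S) := (fun v (i : Fin n) => v (Fin.castLE hk i)) ⁻¹' A
    have hA' : MeasurableSet A' := (measurable_pi_lambda _ fun i => measurable_pi_apply _) hA
    set κ := condDistrib (X k) (firstObs X k) P
    set f : (Fin k → S) × S → ℝ≥0∞ := (A' ×ˢ B').indicator fun q => κ q.1 B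
    have hf : Measurable f :=
      ((Kernel.measurable_coe κ hB).comp measurable_fst).indicator (hA'.prod hB')
    have := h.isCID.lintegral_eq hαₙ hX hα hlim k hf
    have hae := hαₙ.ae_eq_condDistrib hX k
    rw [← lintegral_indicator hs, ← lintegral_indicator (hs.inter (hX k hB'))]
    refine (Eq.trans (lintegral_congr_ae ?_) this).trans (lintegral_congr_ae ?_)
    · filter_upwards [hae] with ω hω
      by_cases hωs : ω ∈ s
      · have e : ∀ y, f (firstObs X k ω, y) = B'.indicator (fun _ => κ (firstObs X k ω) B) y := by
          intro y
          by_cases hy : y ∈ B'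
          · rw [Set.indicator_of_mem hy]
            exact Set.indicator_of_mem (s := A' ×ˢ B') (a := (firstObs X k ω, y)) ⟨hωs, hy⟩ _
          · rw [Set.indicator_of_notMem hy]
            exact Set.indicator_of_notMem (fun hq => hy hq.2) _
        simp_rw [e, lintegral_indicator_const hB', Set.indicator_of_mem hωs, hω]
        rfl
      · have e : ∀ y, f (firstObs X k ω, y) = 0 := fun y =>
          Set.indicator_of_notMem (fun hq => hωs hq.1) _
        simp [e, hωs]
    · filter_upwards [hae] with ω hω
      by_cases hωs : ω ∈ s ∩ X k ⁻¹' B'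
      · rw [Set.indicator_of_mem hωs, hω]
        exact Set.indicator_of_mem (s := A' ×ˢ B') hωs _
      · rw [Set.indicator_of_notMem hωs]
        exact Set.indicator_of_notMem (s := A' ×ˢ B') hωs _
  -- With index `k + 1` the event `X k ∈ B'` is already observed, and exchangeability moves the pair
  -- `(k, k + 1)` back to `(n, n + 1)`.
  have step2 : ∀ k, n ≤ k → ∫⁻ ω in s ∩ X k ⁻¹' B', (αₙ (k + 1) ω : Measure S) B ∂P = p := by
    intro k hk
    set E : Set (Fin (k + 1) → S) :=
      {v | (fun i : Fin n => v (Fin.castLE (hk.trans k.le_succ) i)) ∈ A ∧ v (Fin.last k) ∈ B'}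
    have hE : MeasurableSet E :=
      ((measurable_pi_lambda _ fun i => measurable_pi_apply _) hA).inter
        ((measurable_pi_apply _) hB')
    have e1 := hαₙ.lintegral_apply_eq hX (k + 1) (hE.prod hB)
    have e2 := (h.identDistrib_pair_shift hk).measure_mem_eq (hA.prod (hB'.prod hB))
    rw [← lintegral_indicator (hs.inter (hX k hB'))]
    have e3 : {ω | (firstObs X (k + 1) ω, X (k + 1) ω) ∈ E ×ˢ B}
        = (fun ω => (firstObs X n ω, X k ω, X (k + 1) ω)) ⁻¹' A ×ˢ B' ×ˢ B := by
      ext ω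
      exact and_assoc
    rw [e3] at e1
    refine Eq.trans (lintegral_congr fun ω => ?_) (e1.trans e2)
    by_cases hωs : ω ∈ s ∩ X k ⁻¹' B'
    · have hv : firstObs X (k + 1) ω ∈ E := hωs
      rw [Set.indicator_of_mem hωs, Set.mk_preimage_prod_right hv]
    · have hv : firstObs X (k + 1) ω ∉ E := hωs
      rw [Set.indicator_of_notMem hωs, Set.mk_preimage_prod_right_eq_empty hv, measure_empty]
  have hma : ∀ k, Measurable fun ω => (αₙ k ω : Measure S) B := fun k => (hαₙ k).1 B hB
  have hma' : ∀ k, Measurable fun ω => (αₙ k ω : Measure S).real B :=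
    fun k => (hma k).ennreal_toReal
  have hmr : Measurable fun ω => (α ω : Measure S).real B' := (hα B' hB').ennreal_toReal
  have hint : ∀ k, Integrable (fun ω => (αₙ k ω : Measure S).real B) P := fun k =>
    Integrable.of_bound (hma' k).aestronglyMeasurable 1 (ae_of_all _ fun ω => by
      rw [Real.norm_of_nonneg measureReal_nonneg]; exact measureReal_le_one)
  have lim1 : Tendsto (fun k => ∫ ω in s, (αₙ k ω : Measure S).real B * (α ω : Measure S).real B' ∂P)
      atTop (𝓝 (∫ ω in s, (α ω : Measure S).real B * (α ω : Measure S).real B' ∂P)) := by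
    refine tendsto_integral_of_dominated_convergence (fun _ => 1)
      (fun k => ((hma' k).mul hmr).aestronglyMeasurable) (integrable_const _)
      (fun k => ae_of_all _ fun ω => ?_) ?_
    · rw [Real.norm_of_nonneg (by positivity)]
      exact mul_le_one₀ measureReal_le_one measureReal_nonneg measureReal_le_one
    · filter_upwards [ae_restrict_of_ae hconv] with ω hω using hω.mul_const _
  -- The mismatch between indices `k` and `k + 1` disappears because `αₙ k (B)` converges almost
  -- surely.
  have lim2 : Tendsto (fun k => ∫ ω, (s ∩ X k ⁻¹' B').indicator
      (fun ω => (αₙ k ω : Measure S).real B - (αₙ (k + 1) ω : Measure S).real B) ω ∂P) atTop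
      (𝓝 (∫ _, (0 : ℝ) ∂P)) := by
    refine tendsto_integral_of_dominated_convergence (fun _ => 1)
      (fun k => (((hma' k).sub (hma' (k + 1))).indicator
        (hs.inter (hX k hB'))).aestronglyMeasurable) (integrable_const _)
      (fun k => ae_of_all _ fun ω => ?_) ?_
    · refine (norm_indicator_le_norm_self _ _).trans ?_
      rw [Real.norm_eq_abs, abs_le]
      constructor <;> linarith [measureReal_le_one (μ := (αₙ k ω : Measure S)) (s := B),
        measureReal_le_one (μ := (αₙ (k + 1) ω : Measure S)) (s := B),
        measureReal_nonneg (μ := (αₙ k ω : Measure S)) (s := B),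
        measureReal_nonneg (μ := (αₙ (k + 1) ω : Measure S)) (s := B)]
    · filter_upwards [hconv] with ω hω
      have hz := (hω.sub (hω.comp (tendsto_add_atTop_nat 1))).norm
      rw [sub_self, norm_zero] at hz
      exact squeeze_zero_norm (fun k => norm_indicator_le_norm_self _ _) hz
  rw [integral_zero] at lim2
  have heq : ∀ k, n ≤ k →
      ∫ ω in s, (αₙ k ω : Measure S).real B * (α ω : Measure S).real B' ∂P
        = p.toReal + ∫ ω, (s ∩ X k ⁻¹' B').indicator
          (fun ω => (αₙ k ω : Measure S).real B - (αₙ (k + 1) ω : Measure S).real B) ω ∂P := by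
    intro k hk
    rw [integral_indicator (hs.inter (hX k hB')),
      integral_sub (hint k).integrableOn (hint (k + 1)).integrableOn]
    have t1 := congrArg ENNReal.toReal (step1 k hk)
    have t2 := congrArg ENNReal.toReal (step2 k hk)
    rw [← integral_toReal (f := fun ω => (αₙ k ω : Measure S) B * (α ω : Measure S) B')
      ((hma k).mul (hα B' hB')).aemeasurable
      (ae_of_all _ fun ω => by finiteness), ← integral_toReal (hma k).aemeasurable
      (ae_of_all _ fun ω => by finiteness)] at t1
    rw [← integral_toReal (hma (k + 1)).aemeasurable (ae_of_all _ fun ω => by finiteness)] at t2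
    simp only [ENNReal.toReal_mul] at t1
    simp only [Measure.real]
    rw [t1, t2]
    ring
  have lim3 := (tendsto_const_nhds (x := p.toReal)).add lim2
  rw [add_zero] at lim3
  have hfinal := tendsto_nhds_unique lim1 (lim3.congr' (by
    filter_upwards [eventually_ge_atTop n] with k hk using (heq k hk).symm))
  have hL : ∫⁻ ω in s, (α ω : Measure S) B * (α ω : Measure S) B' ∂P ≠ ∞ := by
    refine ne_top_of_le_ne_top (b := ∫⁻ _ in s, 1 ∂P) (by rw [lintegral_const]; finiteness) ?_
    exact lintegral_mono fun ω => mul_le_one' prob_le_one prob_le_one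
  rw [← ENNReal.toReal_eq_toReal_iff' hL (measure_ne_top _ _), ← hfinal,
    ← integral_toReal (f := fun ω => (α ω : Measure S) B * (α ω : Measure S) B')
      ((hα B hB).mul (hα B' hB')).aemeasurable
      (ae_of_all _ fun ω => by finiteness)]
  simp only [ENNReal.toReal_mul]
  rfl

end

/-! ### Convergence of the point masses. -/

section

theorem atomsConverge_of_ae {Ω S : Type*} [MeasurableSpace Ω] [MeasurableSpace S]
    {P : Measure Ω} [IsProbabilityMeasure P] {αₙ : ℕ → Ω → ProbabilityMeasure S}
    {α : Ω → ProbabilityMeasure S}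
    (h : ∀ᵐ ω ∂P, ∀ x, Tendsto (fun n => (αₙ n ω : Measure S).real {x}) atTop
      (𝓝 ((α ω : Measure S).real {x}))) : AtomsConverge αₙ α P := by
  -- The exceptional set involves all `x` at once and need not be measurable, so it is enlarged to a
  -- measurable null set.
  obtain ⟨t, ht, htm, h0⟩ := exists_measurable_superset_of_null (ae_iff.1 h)
  refine ⟨tᶜ, htm.compl, by rw [prob_compl_eq_one_sub htm, h0, tsub_zero], fun x ω hω => ?_⟩
  by_contra hc
  exact hω (ht fun hall => hc (hall x))

theorem atomsConverge_of_tendsto_tvNorm {Ω S : Type*} [MeasurableSpace Ω] [MeasurableSpace S]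
    [MeasurableSingletonClass S] {P : Measure Ω} [IsProbabilityMeasure P]
    {αₙ : ℕ → Ω → ProbabilityMeasure S} {α : Ω → ProbabilityMeasure S}
    (h : ∀ᵐ ω ∂P, Tendsto (fun n => tvNorm (αₙ n ω) (α ω)) atTop (𝓝 0)) :
    AtomsConverge αₙ α P := by
  refine atomsConverge_of_ae ?_
  filter_upwards [h] with ω hω x
  rw [tendsto_iff_norm_sub_tendsto_zero]
  exact squeeze_zero (fun n => norm_nonneg _)
    (fun n => abs_sub_le_tvNorm _ _ (measurableSet_singleton x)) hω

variable {Ω S : Type*} [MeasurableSpace Ω] [TopologicalSpace S] [PolishSpace S]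
  [MeasurableSpace S] [BorelSpace S] [Nonempty S]
  {P : Measure Ω} [IsProbabilityMeasure P] {X : ℕ → Ω → S}
  {αₙ : ℕ → Ω → ProbabilityMeasure S} {α : Ω → ProbabilityMeasure S}

theorem IsExchangeable.lintegral_prod_apply_eq (h : IsExchangeable X P)
    (hαₙ : IsPredictiveSequence αₙ X P)
    (hX : ∀ n, Measurable (X n)) (hα : IsRandomProbabilityMeasure α)
    (hlim : ∀ᵐ ω ∂P, Tendsto (fun n => αₙ n ω) atTop (𝓝 (α ω))) (n : ℕ)
    {C : Set ((Fin n → S) × S × S)} (hC : MeasurableSet C) :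
    ∫⁻ ω, ((α ω : Measure S).prod (α ω : Measure S)) (Prod.mk (firstObs X n ω) ⁻¹' C) ∂P
      = P {ω | (firstObs X n ω, X n ω, X (n + 1) ω) ∈ C} := by
  have hm := measurable_firstObs hX n
  have hm2 : Measurable (Prod.map (firstObs X n) id : Ω × S × S → _ × S × S) :=
    hm.prodMap measurable_id
  have hm3 := hm.prodMk ((hX n).prodMk (hX (n + 1)))
  set K : Kernel Ω (S × S) := hα.kernel ×ₖ hα.kernel
  have hKa : ∀ ω, K ω = (α ω : Measure S).prod (α ω : Measure S) := fun ω =>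
    Kernel.prod_apply _ _ _
  have hlaw : (P ⊗ₘ K).map (Prod.map (firstObs X n) id)
      = P.map fun ω => (firstObs X n ω, X n ω, X (n + 1) ω) := by
    have : IsProbabilityMeasure ((P ⊗ₘ K).map (Prod.map (firstObs X n) id)) :=
      Measure.isProbabilityMeasure_map hm2.aemeasurable
    refine Measure.ext_prod₃ fun {A B' B} hA hB' hB => ?_
    rw [Measure.map_apply hm2 (hA.prod (hB'.prod hB)), Set.preimage_prod_map_prod,
      Measure.compProd_apply_prod (hm hA) (measurable_id (hB'.prod hB)),
      Measure.map_apply hm3 (hA.prod (hB'.prod hB))]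
    refine Eq.trans (lintegral_congr fun ω => ?_) (h.setLIntegral_mul_eq hαₙ hX hα hlim n hA hB hB')
    rw [hKa, Set.preimage_id, Measure.prod_prod, mul_comm]
  have := congrArg (fun ν => ν C) hlaw
  simp only [Measure.map_apply hm2 hC, Measure.map_apply hm3 hC,
    Measure.compProd_apply (hm2 hC), hKa] at this
  exact this

/-- For an exchangeable sequence, every atom of the limit is one of the observations. -/
theorem IsExchangeable.ae_exists_eq_of_atom (h : IsExchangeable X P)
    (hαₙ : IsPredictiveSequence αₙ X P)
    (hX : ∀ n, Measurable (X n)) (hα : IsRandomProbabilityMeasure α)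
    (hlim : ∀ᵐ ω ∂P, Tendsto (fun n => αₙ n ω) atTop (𝓝 (α ω))) :
    ∀ᵐ ω ∂P, ∀ x, (α ω : Measure S) {x} ≠ 0 → ∃ i, X i ω = x := by
  -- Two draws that tie at a point never observed. An unobserved atom `x` would give this section
  -- mass at least `(α{x})²`.
  set W : Set (Ω × S × S) := {q | q.2.2 = q.2.1 ∧ ∀ i, X i q.1 ≠ q.2.1}
  have hW : MeasurableSet W := by
    have e : W = {q | q.2.2 = q.2.1} ∩ ⋂ i, {q | X i q.1 = q.2.1}ᶜ := by
      ext q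
      simp [W]
    rw [e]
    exact (measurableSet_eq_fun measurable_snd.snd measurable_snd.fst).inter
      (MeasurableSet.iInter fun i =>
        (measurableSet_eq_fun ((hX i).comp measurable_fst) measurable_snd.fst).compl)
  set K : Kernel Ω (S × S) := hα.kernel ×ₖ hα.kernel
  have hKa : ∀ ω, K ω = (α ω : Measure S).prod (α ω : Measure S) := fun ω =>
    Kernel.prod_apply _ _ _
  have hbound : ∀ n : ℕ, ∫⁻ ω, K ω (Prod.mk ω ⁻¹' W) ∂P ≤ ((n : ℝ≥0∞) + 1)⁻¹ := by
    intro n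
    set C : Set ((Fin n → S) × S × S) := {q | q.2.1 = q.2.2 ∧ ∀ i, q.1 i ≠ q.2.1}
    have hC : MeasurableSet C := by
      have e : C = {q | q.2.1 = q.2.2} ∩ ⋂ i, {q | q.1 i = q.2.1}ᶜ := by
        ext q
        simp [C]
      rw [e]
      exact (measurableSet_eq_fun measurable_snd.fst measurable_snd.snd).inter
        (MeasurableSet.iInter fun i => (measurableSet_eq_fun
          ((measurable_pi_apply i).comp measurable_fst) measurable_snd.fst).compl)
    refine le_trans ?_ (h.measure_new_pair_le hX n)
    refine le_of_le_of_eq (lintegral_mono fun ω => ?_)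
      (h.lintegral_prod_apply_eq hαₙ hX hα hlim n hC)
    rw [hKa]
    exact measure_mono fun q hq => ⟨hq.1.symm, fun i => hq.2 i⟩
  have hzero : ∫⁻ ω, K ω (Prod.mk ω ⁻¹' W) ∂P = 0 := by
    have hl : Tendsto (fun n : ℕ => ((n : ℝ≥0∞) + 1)⁻¹) atTop (𝓝 0) := by
      have := (tendsto_add_atTop_iff_nat 1).2 ENNReal.tendsto_inv_nat_nhds_zero
      simpa using this
    exact le_antisymm (ge_of_tendsto' hl hbound) zero_le
  rw [lintegral_eq_zero_iff (Kernel.measurable_kernel_prodMk_left hW)] at hzero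
  filter_upwards [hzero] with ω hω x hx
  by_contra! hne
  have hsub : ({x} : Set S) ×ˢ {x} ⊆ Prod.mk ω ⁻¹' W := by
    rintro ⟨y, z⟩ ⟨hy, hz⟩
    rw [Set.mem_singleton_iff] at hy hz
    simp only at hy hz
    subst hy hz
    exact ⟨rfl, hne⟩
  have := measure_mono_null hsub hω
  rw [hKa, Measure.prod_prod] at this
  exact hx (mul_self_eq_zero.1 this)

theorem IsExchangeable.atomsConverge (h : IsExchangeable X P)
    (hαₙ : IsPredictiveSequence αₙ X P)
    (hX : ∀ n, Measurable (X n)) (hα : IsRandomProbabilityMeasure α)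
    (hlim : ∀ᵐ ω ∂P, Tendsto (fun n => αₙ n ω) atTop (𝓝 (α ω))) :
    AtomsConverge αₙ α P := by
  have hobs : ∀ i, ∀ᵐ ω ∂P, Tendsto (fun n => (αₙ n ω : Measure S).real {X i ω}) atTop
      (𝓝 ((α ω : Measure S).real {X i ω})) := by
    intro i
    -- The singleton `{X i ω}` is a section determined by the first `i + 1` observations.
    have hD : MeasurableSet {q : (Fin (i + 1) → S) × S | q.2 = q.1 (Fin.last i)} :=
      measurableSet_eq_fun measurable_snd ((measurable_pi_apply _).comp measurable_fst)
    filter_upwards [h.isCID.tendsto_measureReal_section hαₙ hX hα hlim (i + 1) hD] with ω hω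
    have e : Prod.mk (firstObs X (i + 1) ω) ⁻¹'
        {q : (Fin (i + 1) → S) × S | q.2 = q.1 (Fin.last i)} = {X i ω} := by
      ext y
      simp [firstObs]
    rwa [e] at hω
  refine atomsConverge_of_ae ?_
  filter_upwards [ae_all_iff.2 hobs, h.ae_exists_eq_of_atom hαₙ hX hα hlim, hlim]
    with ω h1 h2 h3 x
  by_cases hx : (α ω : Measure S) {x} = 0
  · have hls := ProbabilityMeasure.limsup_measure_closed_le_of_tendsto h3 (isClosed_singleton (x := x))
    rw [hx] at hls
    have ht := tendsto_of_le_liminf_of_limsup_le (zero_le) hls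
    have := (ENNReal.tendsto_toReal ENNReal.zero_ne_top).comp ht
    rw [measureReal_def, hx]
    exact this
  · obtain ⟨i, rfl⟩ := h2 x hx
    exact h1 i

end

/-! ### Densities and Lévy's theorem on the product space. -/

section

theorem condExp_ae_le_of_forall_setIntegral_le {Ω : Type*} {m m0 : MeasurableSpace Ω}
    {μ : Measure Ω} [IsFiniteMeasure μ] (hm : m ≤ m0) {f g : Ω → ℝ} (hf : Integrable f μ)
    (hg : Integrable g μ) (hgm : StronglyMeasurable[m] g)
    (h : ∀ s, MeasurableSet[m] s → ∫ x in s, f x ∂μ ≤ ∫ x in s, g x ∂μ) : μ[f | m] ≤ᵐ[μ] g := by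
  refine ae_le_of_ae_le_trim (hm := hm) (ae_le_of_forall_setIntegral_le
    (integrable_condExp.trim hm stronglyMeasurable_condExp) (hg.trim hm hgm) fun s hs _ => ?_)
  rw [← setIntegral_trim hm stronglyMeasurable_condExp hs, ← setIntegral_trim hm hgm hs,
    setIntegral_condExp hm hf hs]
  exact h s hs

theorem setLIntegral_prod_section {Ω S : Type*} [MeasurableSpace Ω] [MeasurableSpace S]
    {P : Measure Ω} {ρ : Measure S} [SFinite P] [SFinite ρ] {u : Ω × S → ℝ≥0∞} (hu : Measurable u)
    {E : Set (Ω × S)} (hE : MeasurableSet E) :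
    ∫⁻ p in E, u p ∂(P.prod ρ) = ∫⁻ ω, ∫⁻ y in Prod.mk ω ⁻¹' E, u (ω, y) ∂ρ ∂P := by
  rw [← lintegral_indicator hE, lintegral_prod _ (hu.indicator hE).aemeasurable]
  refine lintegral_congr fun ω => ?_
  rw [← lintegral_indicator (measurable_prodMk_left hE)]
  rfl

section KernelDensity

variable {T S : Type*} [MeasurableSpace T] [MeasurableSpace S]
  [MeasurableSpace.CountableOrCountablyGenerated T S]

theorem setLIntegral_rnDeriv_const_le (κ : Kernel T S) [IsFiniteKernel κ] (ρ : Measure S)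
    [IsFiniteMeasure ρ] (t : T) {B : Set S} (hB : MeasurableSet B) :
    ∫⁻ y in B, κ.rnDeriv (Kernel.const T ρ) t y ∂ρ ≤ κ t B :=
  Kernel.setLIntegral_rnDeriv_le (η := Kernel.const T ρ) hB

theorem setLIntegral_rnDeriv_const_eq (κ : Kernel T S) [IsFiniteKernel κ] (ρ : Measure S)
    [IsFiniteMeasure ρ] (t : T) {B : Set S} (hB : MeasurableSet B)
    (h : Disjoint B (κ.mutuallySingularSetSlice (Kernel.const T ρ) t)) :
    ∫⁻ y in B, κ.rnDeriv (Kernel.const T ρ) t y ∂ρ = κ t B := by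
  rw [← Kernel.withDensity_rnDeriv_of_subset_compl_mutuallySingularSetSlice (η := Kernel.const T ρ)
    hB h.subset_compl_right, Kernel.withDensity_apply' _ (Kernel.measurable_rnDeriv _ _)]
  rfl

/-- The singular part sits on a `ρ`-null slice, which by hypothesis has no mass inside `B`; absolute
continuity is needed only there. -/
theorem le_setLIntegral_rnDeriv_const (κ : Kernel T S) [IsFiniteKernel κ] (ρ : Measure S)
    [IsFiniteMeasure ρ] (t : T) {B : Set S} (hB : MeasurableSet B)
    (h : ∀ E, MeasurableSet E → E ⊆ B → ρ E = 0 → κ t E = 0) :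
    κ t B ≤ ∫⁻ y in B, κ.rnDeriv (Kernel.const T ρ) t y ∂ρ := by
  set N := κ.mutuallySingularSetSlice (Kernel.const T ρ) t
  have hN : MeasurableSet N := κ.measurableSet_mutuallySingularSetSlice _ t
  have hN0 : ρ N = 0 := κ.measure_mutuallySingularSetSlice (Kernel.const T ρ) t
  rw [← measure_inter_add_sdiff B hN, h _ (hB.inter hN) Set.inter_subset_left
    (measure_mono_null Set.inter_subset_right hN0), zero_add,
    ← setLIntegral_rnDeriv_const_eq κ ρ t (hB.diff hN) Set.disjoint_sdiff_left]
  exact lintegral_mono_set Set.sdiff_subset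

end KernelDensity

/-- The observations together with an independent variable, as a filtration. -/
def extendedObsFiltration {Ω S : Type*} [MeasurableSpace Ω] [MeasurableSpace S] {X : ℕ → Ω → S}
    (hX : ∀ n, Measurable (X n)) : Filtration ℕ (inferInstance : MeasurableSpace (Ω × S)) where
  seq n := MeasurableSpace.comap (fun p : Ω × S => (firstObs X n p.1, p.2)) inferInstance
  mono' n m h := by
    have hr : Measurable fun q : (Fin m → S) × S => ((fun i : Fin n => q.1 (Fin.castLE h i)), q.2) :=
      (measurable_pi_lambda _ fun i => (measurable_pi_apply _).comp measurable_fst).prodMk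
        measurable_snd
    exact Measurable.comap_le (hr.comp (comap_measurable fun p : Ω × S => (firstObs X m p.1, p.2)))
  le' n := (((measurable_firstObs hX n).comp measurable_fst).prodMk measurable_snd).comap_le

theorem measurable_iSup_extendedObsFiltration {Ω S : Type*} [MeasurableSpace Ω]
    [MeasurableSpace S] {X : ℕ → Ω → S} (hX : ∀ n, Measurable (X n)) :
    Measurable[⨆ n, extendedObsFiltration hX n] fun p : Ω × S => ((fun i => X i p.1), p.2) := by
  have hle : ∀ n, extendedObsFiltration hX n ≤ ⨆ n, extendedObsFiltration hX n :=
    fun n => le_iSup (fun n => extendedObsFiltration hX n) n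
  have h1 : Measurable[⨆ n, extendedObsFiltration hX n] fun (p : Ω × S) i => X i p.1 := by
    refine @measurable_pi_lambda _ _ _ (⨆ n, extendedObsFiltration hX n) _ _ fun i => ?_
    have h : Measurable[extendedObsFiltration hX (i + 1)] fun p : Ω × S => X i p.1 :=
      ((measurable_pi_apply (Fin.last i)).comp measurable_fst).comp
        (comap_measurable fun p : Ω × S => (firstObs X (i + 1) p.1, p.2))
    exact h.mono (hle (i + 1)) le_rfl
  have h2 : Measurable[⨆ n, extendedObsFiltration hX n] fun p : Ω × S => p.2 := by
    have h : Measurable[extendedObsFiltration hX 0] fun p : Ω × S => p.2 :=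
      (measurable_snd (α := Fin 0 → S)).comp
        (comap_measurable fun p : Ω × S => (firstObs X 0 p.1, p.2))
    exact h.mono (hle 0) le_rfl
  exact h1.prodMk h2

variable {Ω S : Type*} [MeasurableSpace Ω] [TopologicalSpace S] [PolishSpace S]
  [MeasurableSpace S] [BorelSpace S] [Nonempty S]
  {P : Measure Ω} [IsProbabilityMeasure P] {X : ℕ → Ω → S}
  {αₙ : ℕ → Ω → ProbabilityMeasure S} {α : Ω → ProbabilityMeasure S}

/-- The densities of the absolutely continuous parts of the predictive measures asymptotically
dominate the density of the absolutely continuous part of the limit. -/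
theorem IsCID.tendsto_rnDeriv_tsub (h : IsCID X P) (hαₙ : IsPredictiveSequence αₙ X P)
    (hX : ∀ n, Measurable (X n)) (hα : IsRandomProbabilityMeasure α)
    (hlim : ∀ᵐ ω ∂P, Tendsto (fun n => αₙ n ω) atTop (𝓝 (α ω)))
    {κ : Kernel (ℕ → S) S} [IsMarkovKernel κ]
    (hκ : ∀ᵐ ω ∂P, (α ω : Measure S) = κ fun i => X i ω) (ρ : Measure S) [IsFiniteMeasure ρ] :
    ∀ᵐ ω ∂P, ∀ᵐ y ∂ρ, Tendsto (fun n => κ.rnDeriv (Kernel.const _ ρ) (fun i => X i ω) y -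
      (condDistrib (X n) (firstObs X n) P).rnDeriv (Kernel.const _ ρ) (firstObs X n ω) y)
      atTop (𝓝 0) := by
  have hXm : Measurable fun ω i => X i ω := measurable_pi_lambda _ hX
  set κ' := fun n => condDistrib (X n) (firstObs X n) P
  set μ := P.prod ρ
  set Φ : (n : ℕ) → Ω × S → (Fin n → S) × S := fun n p => (firstObs X n p.1, p.2)
  have hΦ : ∀ n, Measurable (Φ n) := fun n =>
    ((measurable_firstObs hX n).comp measurable_fst).prodMk measurable_snd
  set f : Ω × S → ℝ≥0∞ := fun p => κ.rnDeriv (Kernel.const _ ρ) (fun i => X i p.1) p.2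
  set g : ℕ → Ω × S → ℝ≥0∞ := fun n p =>
    (κ' n).rnDeriv (Kernel.const _ ρ) (firstObs X n p.1) p.2
  have hfG : Measurable[⨆ n, extendedObsFiltration hX n] f :=
    (κ.measurable_rnDeriv (Kernel.const _ ρ)).comp (measurable_iSup_extendedObsFiltration hX)
  have hf : Measurable f := hfG.mono (iSup_le fun n => (extendedObsFiltration hX).le n) le_rfl
  have hgG : ∀ n, Measurable[extendedObsFiltration hX n] (g n) := fun n =>
    ((κ' n).measurable_rnDeriv (Kernel.const _ ρ)).comp (comap_measurable (Φ n))
  have hg : ∀ n, Measurable (g n) := fun n =>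
    (hgG n).mono ((extendedObsFiltration hX).le n) le_rfl
  have hfint : ∫⁻ p, f p ∂μ ≠ ∞ := by
    refine ne_top_of_le_ne_top ENNReal.one_ne_top ?_
    rw [← setLIntegral_univ, setLIntegral_prod_section hf MeasurableSet.univ]
    calc _ ≤ ∫⁻ ω, κ (fun i => X i ω) Set.univ ∂P :=
          lintegral_mono fun ω => setLIntegral_rnDeriv_const_le κ ρ _ MeasurableSet.univ
      _ = 1 := by simp
  have hgint : ∀ n, ∫⁻ p, g n p ∂μ ≠ ∞ := by
    intro n
    refine ne_top_of_le_ne_top ENNReal.one_ne_top ?_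
    rw [← setLIntegral_univ, setLIntegral_prod_section (hg n) MeasurableSet.univ]
    calc _ ≤ ∫⁻ ω, κ' n (firstObs X n ω) Set.univ ∂P :=
          lintegral_mono fun ω => setLIntegral_rnDeriv_const_le (κ' n) ρ _ MeasurableSet.univ
      _ = 1 := by simp
  have hle : ∀ n C, MeasurableSet C → ∫⁻ p in Φ n ⁻¹' C, f p ∂μ ≤ ∫⁻ p in Φ n ⁻¹' C, g n p ∂μ := by
    intro n C hC
    -- `N` carries the singular part of the predictive measure. Its sections are `ρ`-null, so
    -- removing it leaves the integral of `f` unchanged; off `N` the predictive measure is exactly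
    -- its density. The inequality arises because `f` may miss a singular part of `α`.
    set N := (κ' n).mutuallySingularSet (Kernel.const _ ρ)
    have hN : MeasurableSet N := (κ' n).measurableSet_mutuallySingularSet _
    have hμN : μ (Φ n ⁻¹' N) = 0 := by
      rw [Measure.prod_apply (hΦ n hN), lintegral_eq_zero_iff
        (measurable_measure_prodMk_left (hΦ n hN))]
      exact ae_of_all _ fun ω =>
        (κ' n).measure_mutuallySingularSetSlice (Kernel.const _ ρ) (firstObs X n ω)
    have hD : MeasurableSet (C \ N) := hC.diff hN
    have hsec : ∀ ω, MeasurableSet (Prod.mk ω ⁻¹' (Φ n ⁻¹' (C \ N))) :=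
      fun ω => measurable_prodMk_left (hΦ n hD)
    calc ∫⁻ p in Φ n ⁻¹' C, f p ∂μ = ∫⁻ p in Φ n ⁻¹' (C \ N), f p ∂μ := by
          refine setLIntegral_congr ?_
          rw [Set.preimage_sdiff]
          exact (sdiff_null_ae_eq_self hμN).symm
      _ = ∫⁻ ω, ∫⁻ y in Prod.mk ω ⁻¹' (Φ n ⁻¹' (C \ N)), f (ω, y) ∂ρ ∂P :=
          setLIntegral_prod_section hf (hΦ n hD)
      _ ≤ ∫⁻ ω, κ (fun i => X i ω) (Prod.mk ω ⁻¹' (Φ n ⁻¹' (C \ N))) ∂P :=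
          lintegral_mono fun ω => setLIntegral_rnDeriv_const_le κ ρ _ (hsec ω)
      _ = ∫⁻ ω, (α ω : Measure S) (Prod.mk (firstObs X n ω) ⁻¹' (C \ N)) ∂P :=
          lintegral_congr_ae (by filter_upwards [hκ] with ω hω; rw [hω]; rfl)
      _ = ∫⁻ ω, (αₙ n ω : Measure S) (Prod.mk (firstObs X n ω) ⁻¹' (C \ N)) ∂P := by
          rw [h.lintegral_apply_eq hαₙ hX hα hlim n hD, hαₙ.lintegral_apply_eq hX n hD]
      _ = ∫⁻ ω, ∫⁻ y in Prod.mk ω ⁻¹' (Φ n ⁻¹' (C \ N)), g n (ω, y) ∂ρ ∂P := by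
          refine lintegral_congr_ae ?_
          filter_upwards [hαₙ.ae_eq_condDistrib hX n] with ω hω
          rw [hω]
          refine (setLIntegral_rnDeriv_const_eq (κ' n) ρ (firstObs X n ω) (hsec ω) ?_).symm
          exact Set.disjoint_left.2 fun y hy hyN => hy.2 hyN
      _ = ∫⁻ p in Φ n ⁻¹' (C \ N), g n p ∂μ := (setLIntegral_prod_section (hg n) (hΦ n hD)).symm
      _ ≤ ∫⁻ p in Φ n ⁻¹' C, g n p ∂μ :=
          lintegral_mono_set (Set.preimage_mono Set.sdiff_subset)
  have hfi : Integrable (fun p => (f p).toReal) μ :=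
    integrable_toReal_of_lintegral_ne_top hf.aemeasurable hfint
  have hgi : ∀ n, Integrable (fun p => (g n p).toReal) μ := fun n =>
    integrable_toReal_of_lintegral_ne_top (hg n).aemeasurable (hgint n)
  have hcond : ∀ n, μ[fun p => (f p).toReal | extendedObsFiltration hX n] ≤ᵐ[μ]
      fun p => (g n p).toReal := by
    intro n
    refine condExp_ae_le_of_forall_setIntegral_le ((extendedObsFiltration hX).le n) hfi (hgi n)
      (hgG n).ennreal_toReal.stronglyMeasurable ?_
    rintro s ⟨C, hC, rfl⟩
    rw [integral_toReal hf.aemeasurable (ae_restrict_of_ae (ae_lt_top hf hfint)),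
      integral_toReal (hg n).aemeasurable (ae_restrict_of_ae (ae_lt_top (hg n) (hgint n)))]
    exact ENNReal.toReal_mono
      (ne_top_of_le_ne_top (hgint n) (setLIntegral_le_lintegral _ _)) (hle n C hC)
  have hlevy := hfi.tendsto_ae_condExp (ℱ := extendedObsFiltration hX)
    hfG.ennreal_toReal.stronglyMeasurable
  have hall : ∀ᵐ p ∂μ, Tendsto (fun n => f p - g n p) atTop (𝓝 0) := by
    filter_upwards [hlevy, ae_all_iff.2 hcond, ae_lt_top hf hfint] with p h1 h2 h3
    have h4 := ENNReal.tendsto_ofReal (h1.const_sub (f p).toReal)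
    rw [sub_self, ENNReal.ofReal_zero] at h4
    refine tendsto_of_tendsto_of_tendsto_of_le_of_le tendsto_const_nhds h4
      (fun n => zero_le) fun n => ?_
    calc f p - g n p ≤ ENNReal.ofReal (f p).toReal - ENNReal.ofReal (g n p).toReal := by
          rw [ENNReal.ofReal_toReal h3.ne]
          exact tsub_le_tsub_left ENNReal.ofReal_toReal_le _
      _ = ENNReal.ofReal ((f p).toReal - (g n p).toReal) :=
          (ENNReal.ofReal_sub _ ENNReal.toReal_nonneg).symm
      _ ≤ _ := ENNReal.ofReal_le_ofReal (sub_le_sub_left (h2 n) _)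
  exact Measure.ae_ae_of_ae_prod hall

theorem IsCID.tendsto_tvNorm (h : IsCID X P) (hαₙ : IsPredictiveSequence αₙ X P)
    (hX : ∀ n, Measurable (X n)) (hα : IsRandomProbabilityMeasure α)
    (hlim : ∀ᵐ ω ∂P, Tendsto (fun n => αₙ n ω) atTop (𝓝 (α ω))) (lam : Measure S)
    [SigmaFinite lam] (hac : ∀ᵐ ω ∂P, continuousPart (α ω : Measure S) ≪ lam)
    (hat : AtomsConverge αₙ α P) :
    ∀ᵐ ω ∂P, Tendsto (fun n => tvNorm (αₙ n ω) (α ω)) atTop (𝓝 0) := by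
  obtain ⟨κ, _, hκ⟩ := hαₙ.exists_kernel_ae_eq hX hα hlim
  -- A finite measure with the null sets of `lam`.
  set ρ := lam.toFinite
  obtain ⟨A₀, hA₀, hA₀1, hA₀lim⟩ := hat
  have hA₀ae : ∀ᵐ ω ∂P, ω ∈ A₀ := (mem_ae_iff_prob_eq_one hA₀).2 hA₀1
  filter_upwards [hac, hκ, hA₀ae, ae_all_iff.2 fun n => hαₙ.ae_eq_condDistrib hX n,
    h.tendsto_rnDeriv_tsub hαₙ hX hα hlim hκ ρ] with ω h1 h2 h3 h4 h5
  refine tendsto_tvNorm_of_density_of_atoms (α ω) (fun n => αₙ n ω) ρ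
    (κ.rnDeriv (Kernel.const _ ρ) fun i => X i ω)
    (fun n => (condDistrib (X n) (firstObs X n) P).rnDeriv (Kernel.const _ ρ) (firstObs X n ω))
    (Kernel.measurable_rnDeriv_right _ _ _) (fun n => Kernel.measurable_rnDeriv_right _ _ _)
    ?_ ?_ ?_ h5 fun x => hA₀lim x ω h3
  · rw [← setLIntegral_univ]
    exact ne_top_of_le_ne_top (measure_ne_top _ _)
      (setLIntegral_rnDeriv_const_le κ ρ _ MeasurableSet.univ)
  · intro B hB hB0
    rw [h2] at hB0 h1 ⊢
    refine le_setLIntegral_rnDeriv_const κ ρ _ hB fun E hE hEB h0 => ?_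
    -- Without atoms in `E`, the mass of `E` is bounded by that of the continuous part, which
    -- vanishes on null sets.
    refine le_antisymm ((le_continuousPart_apply_of_singleton_eq_zero _ hE
      fun x hx => hB0 x (hEB hx)).trans_eq ?_) zero_le
    exact h1 (absolutelyContinuous_toFinite lam h0)
  · intro n B hB
    rw [h4 n]
    exact setLIntegral_rnDeriv_const_le _ ρ _ hB

end

end PredictiveMeasure


theorem theorem2 {Ω S : Type*} [MeasurableSpace Ω] [TopologicalSpace S] [PolishSpace S]
    [MeasurableSpace S] [BorelSpace S]
    (P : Measure Ω) [IsProbabilityMeasure P]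
    (X : ℕ → Ω → S) (hX : ∀ n, Measurable (X n))
    (lam : Measure S) [SigmaFinite lam]
    (αₙ : ℕ → Ω → ProbabilityMeasure S)
    (hαₙ : PredictiveMeasure.IsPredictiveSequence αₙ X P)
    (α : Ω → ProbabilityMeasure S)
    (hα : PredictiveMeasure.IsRandomProbabilityMeasure α)
    (hlim : ∀ᵐ ω ∂P, Tendsto (fun n => αₙ n ω) atTop (𝓝 (α ω))) :
    (PredictiveMeasure.IsCID X P →
      (∀ᵐ ω ∂P, PredictiveMeasure.continuousPart (α ω : Measure S) ≪ lam) →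
      ((∀ᵐ ω ∂P, Tendsto (fun n => PredictiveMeasure.tvNorm (αₙ n ω) (α ω)) atTop (𝓝 0)) ↔
        PredictiveMeasure.AtomsConverge αₙ α P)) ∧
    (PredictiveMeasure.IsExchangeable X P → PredictiveMeasure.AtomsConverge αₙ α P) ∧
    (PredictiveMeasure.IsExchangeable X P →
      (∀ᵐ ω ∂P, PredictiveMeasure.continuousPart (α ω : Measure S) ≪ lam) →
      ∀ᵐ ω ∂P, Tendsto (fun n => PredictiveMeasure.tvNorm (αₙ n ω) (α ω)) atTop (𝓝 0)) := by
  -- Conditional distributions require `S` to be nonempty; any value of `X 0` provides a point.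
  obtain ⟨ω₀⟩ := nonempty_of_isProbabilityMeasure P
  have : Nonempty S := ⟨X 0 ω₀⟩
  refine ⟨fun h hac => ⟨PredictiveMeasure.atomsConverge_of_tendsto_tvNorm,
    h.tendsto_tvNorm hαₙ hX hα hlim lam hac⟩, fun h => h.atomsConverge hαₙ hX hα hlim,
    fun h hac => ?_⟩
  exact h.isCID.tendsto_tvNorm hαₙ hX hα hlim lam hac (h.atomsConverge hαₙ hX hα hlim)
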